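/- Let $X$ be a complete separable metric space with Borel $\sigma$-algebra $\mathcal A$, let $\mu$ be a measure on $(X,\mathcal A)$ that is finite on bounded Borel sets and satisfies $\mu(X)=\infty$, and let $T:X\to X$ be an invertible bi-measurable transformation preserving $\mu$, such that $(X,\mathcal A,\mu,T)$ is conservative and ergodic. Let $X^*$ be the set of simple counting measures on $X$, i.e. of measures that are finite on bounded Borel sets and of the form $\xi=\sum_{i\in I}\delta_{x_i}$ with $I$ at most countable and the points $x_i$ pairwise distinct, equipped with the $\sigma$-algebra $\mathcal A^*$ generated by the maps $\xi\mapsto\xi(A)$, $A\in\mathcal A$ bounded. A *$T$-point process* is a random variable $N$ on some probability space $(\Omega,\mathscr F,\mathbb P)$ with values in $(X^*,\mathcal A^*)$ such that (i) for every $A\in\mathcal A$ with $\mu(A)=0$, $N(A)=0$ $\mathbb P$-almost surely; and (ii) there is an invertible measure-preserving transformation $S$ of $(\Omega,\mathscr F,\mathbb P)$ with $N(A)\circ S=N(T^{-1}A)$ for every $A\in\mathcal A$. It has *intensity* $\mu$ if $\mathbb E[N(A)]=\mu(A)$ for every $A\in\mathcal A$. We write $x\in N(\omega)$ if $N(\omega)(\{x\})=1$.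 Then there exists a $T$-point process $N$ with intensity $\mu$ such that, with probability $1$, for every $x\in N(\omega)$, $$N(\omega)\big(\{T^kx:\ k\in\mathbb Z\}\big)=\infty .$$ -/

import Mathlib

open MeasureTheory Set
open scoped ENNReal

universe u

namespace TPoint

/-- A Borel measure on a metric space is boundedly finite if bounded Borel sets have finite mass. -/
def BoundedlyFinite {X : Type*} [MetricSpace X] [MeasurableSpace X] (ξ : Measure X) : Prop :=
  ∀ A : Set X, MeasurableSet A → Bornology.IsBounded A → ξ A < ∞

/-- The space `X^*` of simple counting measures on `X`: the boundedly finite measures of the form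
`∑ x ∈ s, δ_x`, where `s` is an at most countable set of (hence pairwise distinct) points. -/
def SimpleCountingMeasure (X : Type*) [MetricSpace X] [MeasurableSpace X] : Type _ :=
  {ξ : Measure X // BoundedlyFinite ξ ∧
    ∃ s : Set X, s.Countable ∧ ξ = Measure.sum (fun x : s => Measure.dirac (x : X))}

namespace SimpleCountingMeasure

/-- The simple counting measure `ξ`, seen as a measure on `X`. -/
def toMeasure {X : Type*} [MetricSpace X] [MeasurableSpace X] (ξ : SimpleCountingMeasure X) :
    Measure X :=
  ξ.val

/-- The σ-algebra `𝒜^*` on `X^*`, generated by the maps `ξ ↦ ξ A` for `A` bounded Borel. -/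
instance instMeasurableSpace (X : Type*) [MetricSpace X] [MeasurableSpace X] :
    MeasurableSpace (SimpleCountingMeasure X) :=
  ⨆ (A : Set X) (_ : MeasurableSet A) (_ : Bornology.IsBounded A),
    MeasurableSpace.comap (fun ξ : SimpleCountingMeasure X => ξ.toMeasure A)
      (inferInstance : MeasurableSpace ℝ≥0∞)

end SimpleCountingMeasure

/-- `N` is a `T`-point process on the probability space `(Ω, P)`, where `T` is an invertible
transformation of `(X, μ)`: a point process on `X` (a random variable with values in `X^*`) which
a.s. does not charge a given `μ`-null set, and for which some invertible measure-preserving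
transformation `S` of `(Ω, P)` satisfies `N(A) ∘ S = N(T⁻¹ A)` for all Borel sets `A`. -/
structure IsTPointProcess {X : Type*} [MetricSpace X] [MeasurableSpace X] (μ : Measure X)
    (T : X ≃ᵐ X) {Ω : Type*} [MeasurableSpace Ω] (P : Measure Ω)
    (N : Ω → SimpleCountingMeasure X) : Prop where
  isProbabilityMeasure : IsProbabilityMeasure P
  measurable : Measurable N
  ae_null : ∀ A : Set X, MeasurableSet A → μ A = 0 → ∀ᵐ ω ∂P, (N ω).toMeasure A = 0
  exists_factor : ∃ S : Ω ≃ᵐ Ω, MeasurePreserving S P P ∧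
    ∀ A : Set X, MeasurableSet A →
      ∀ ω : Ω, (N (S ω)).toMeasure A = (N ω).toMeasure (T ⁻¹' A)

/-- The point process `N` has intensity `μ`: `𝔼[N(A)] = μ(A)` for all Borel sets `A`. -/
def HasIntensity {X : Type*} [MetricSpace X] [MeasurableSpace X] {Ω : Type*} [MeasurableSpace Ω]
    (P : Measure Ω) (N : Ω → SimpleCountingMeasure X) (μ : Measure X) : Prop :=
  ∀ A : Set X, MeasurableSet A → ∫⁻ ω, (N ω).toMeasure A ∂P = μ A

/-- The two-sided orbit `{T^k x : k ∈ ℤ}`. -/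
def orbit {X : Type*} [MeasurableSpace X] (T : X ≃ᵐ X) (x : X) : Set X :=
  Set.range (fun k : ℤ => ((T.toEquiv : Equiv.Perm X) ^ k) x)

end TPoint

/-! The process is a Poisson superposition of random infinite pieces of orbits. Adjoin to a point
`x` a sequence of fair coins. Flipping a finite set `F` of coins moves `x` along its orbit: coin `i`
contributes `+h i` or `-h i` according to its current value. These moves form a measure-preserving
action of the group of finite sets under symmetric difference on `coins.prod μ`, and the positions
in the class of a pair form its cluster, an infinite part of one orbit.

The times `h n` are chosen so sparse that almost every class carries a summable positive function.
This is possible because in infinite measure an ergodic `T` has no nonzero invariant L² vector; by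
the mean ergodic theorem, sets of finite measure are nearly disjoint from their translates along
some large times (`exists_window_measure_inter_le`). Normalising on each class gives a weight `g` of
total mass one on almost every class (`exists_weight`).

Take a Poisson process on pairs with intensity `g` times `coins.prod μ`, and superpose the clusters
of its points. Mass transport along the moves shows that the intensity is `μ`
(`lintegral_cluster_mul_weight`). Replacing `g` by another weight leaves integrals of
class-invariant functions unchanged (`lintegral_mul_weight_eq`); hence the Laplace functional, and
with it the law, is invariant under `T` (`map_map_superpose`). Almost surely the superposition is
simple, since `T` acts freely a.e. and orbits are null, and every charged orbit contains a whole
cluster. The probability space is then the space of configurations itself, with push-forward by `T`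
as its transformation. -/

namespace TPoint

open Filter Topology

/-! ### Iterates of `T` and near-disjointness at large times -/

section Iterates

variable {X : Type*} [MeasurableSpace X] (T : X ≃ᵐ X) {μ : Measure X}

/-- The `k`-th iterate of `T`, for `k` an integer. -/
def iter (k : ℤ) (x : X) : X := ((T.toEquiv : Equiv.Perm X) ^ k) x

@[simp] lemma iter_zero (x : X) : iter T 0 x = x := rfl

lemma iter_one (x : X) : iter T 1 x = T x := rfl

lemma iter_add (a b : ℤ) (x : X) : iter T (a + b) x = iter T a (iter T b x) := by
  simp [iter, zpow_add]

lemma iter_natCast (n : ℕ) (x : X) : iter T n x = T^[n] x := by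
  induction n generalizing x with
  | zero => rfl
  | succ n ih => rw [Nat.cast_succ, iter_add, ih, Function.iterate_succ_apply, iter_one]

@[simp] lemma iter_neg_iter (a : ℤ) (x : X) : iter T (-a) (iter T a x) = x := by
  rw [← iter_add]; simp

@[simp] lemma iter_iter_neg (a : ℤ) (x : X) : iter T a (iter T (-a) x) = x := by
  rw [← iter_add]; simp

lemma iter_comm (a : ℤ) (x : X) : iter T a (T x) = T (iter T a x) := by
  rw [← iter_one, ← iter_one, ← iter_add, ← iter_add, add_comm]

lemma iter_injective (a : ℤ) : Function.Injective (iter T a) :=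
  ((T.toEquiv : Equiv.Perm X) ^ a).injective

lemma iter_neg_one : iter T (-1) = T.symm := by
  ext x
  apply iter_injective T 1
  simp [iter_one]

lemma measurable_iter (k : ℤ) : Measurable (iter T k) := by
  induction k using Int.induction_on with
  | zero => exact measurable_id
  | succ n ih =>
    have : iter T (n + 1) = iter T n ∘ T := by ext x; simp [iter_add, iter_one]
    rw [this]
    exact ih.comp T.measurable
  | pred n ih =>
    have : iter T (-n - 1) = iter T (-n) ∘ T.symm := by
      ext x; rw [sub_eq_add_neg, iter_add, iter_neg_one]; rfl
    rw [this]
    exact ih.comp T.symm.measurable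

lemma measurePreserving_iter (hT : MeasurePreserving T μ μ) (k : ℤ) :
    MeasurePreserving (iter T k) μ μ := by
  induction k using Int.induction_on with
  | zero => exact MeasurePreserving.id μ
  | succ n ih =>
    have : iter T (n + 1) = iter T n ∘ T := by ext x; simp [iter_add, iter_one]
    rw [this]
    exact ih.comp hT
  | pred n ih =>
    have : iter T (-n - 1) = iter T (-n) ∘ T.symm := by
      ext x; rw [sub_eq_add_neg, iter_add, iter_neg_one]; rfl
    rw [this]
    exact ih.comp (hT.symm T)

lemma countable_orbit (x : X) : (orbit T x).Countable := countable_range _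

lemma iter_mem_orbit_iter (x : X) (a b : ℤ) : iter T b x ∈ orbit T (iter T a x) :=
  ⟨b - a, by
    change iter T (b - a) (iter T a x) = _
    rw [← iter_add]; simp⟩

lemma orbit_iter (k : ℤ) (x : X) : orbit T (iter T k x) = orbit T x := by
  ext z
  constructor
  · rintro ⟨j, rfl⟩
    exact ⟨j + k, iter_add T j k x⟩
  · rintro ⟨j, rfl⟩
    exact iter_mem_orbit_iter T x k j

lemma map_iter_map_iter (ξ : Measure X) (a b : ℤ) :
    (ξ.map (iter T b)).map (iter T a) = ξ.map (iter T (a + b)) := by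
  rw [Measure.map_map (measurable_iter T a) (measurable_iter T b)]
  congr 1
  ext x
  exact (iter_add T a b x).symm

/-- Two sets of finite measure are nearly disjoint along some large time. -/
lemma exists_measure_inter_preimage_iterate_lt (herg : Ergodic T μ) (hinf : μ univ = ∞)
    {B : Set X} (hB : MeasurableSet B) (hBfin : μ B ≠ ∞) {ε : ℝ≥0∞} (hε : ε ≠ 0) (M : ℕ) :
    ∃ n > M, μ (B ∩ T^[n] ⁻¹' B) < ε := by
  by_contra! hcon
  have hT := herg.toMeasurePreserving
  set U : Lp ℝ 2 μ →ₗᵢ[ℝ] Lp ℝ 2 μ := Lp.compMeasurePreservingₗᵢ ℝ T hT with hU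
  set f : Lp ℝ 2 μ := indicatorConstLp 2 hB hBfin 1 with hf
  have hUn : ∀ n : ℕ, ∃ hfin, (U^[n]) f =
      indicatorConstLp 2 ((hT.iterate n).measurable hB) hfin (1 : ℝ) := by
    intro n
    have hfin : μ (T^[n] ⁻¹' B) ≠ ∞ := by
      rwa [(hT.iterate n).measure_preimage hB.nullMeasurableSet]
    refine ⟨hfin, ?_⟩
    induction n with
    | zero => rfl
    | succ n ih =>
      have hfin' : μ (T^[n] ⁻¹' B) ≠ ∞ := by
        rwa [(hT.iterate n).measure_preimage hB.nullMeasurableSet]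
      rw [Function.iterate_succ_apply', ih hfin']
      exact Lp.indicatorConstLp_compMeasurePreserving _ hfin' _ hT
  have hinner : ∀ n : ℕ, inner ℝ f (U^[n] f) = μ.real (B ∩ T^[n] ⁻¹' B) := by
    intro n
    obtain ⟨hfin, h⟩ := hUn n
    rw [h, hf, L2.inner_indicatorConstLp_one]
    rw [setIntegral_congr_ae hB
      (indicatorConstLp_coeFn.mono fun x hx _ => hx)]
    rw [setIntegral_indicator ((hT.iterate n).measurable hB)]
    simp
  have hlim := U.toContinuousLinearMap.tendsto_birkhoffAverage_orthogonalProjection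
    U.norm_toContinuousLinearMap_le f
  set p := (U.toContinuousLinearMap.eqLocus
    (1 : Lp ℝ 2 μ →L[ℝ] Lp ℝ 2 μ)).orthogonalProjectionOnto f with hp
  -- By ergodicity an invariant L² function is constant, and the only constant in L² of an infinite
  -- measure is zero.
  have hp0 : (p : Lp ℝ 2 μ) = 0 := by
    have hinv : U (p : Lp ℝ 2 μ) = p := p.2
    have hae : (p : Lp ℝ 2 μ) ∘ T =ᵐ[μ] (p : Lp ℝ 2 μ) := by
      refine (Lp.coeFn_compMeasurePreserving (p : Lp ℝ 2 μ) hT).symm.trans ?_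
      exact Filter.EventuallyEq.of_eq (congrArg (fun q : Lp ℝ 2 μ => (q : X → ℝ)) hinv)
    obtain ⟨c, hc⟩ := herg.quasiErgodic.ae_eq_const_of_ae_eq_comp_ae
      (Lp.aestronglyMeasurable _) hae
    have hmem : MemLp (fun _ : X => c) 2 μ := (memLp_congr_ae hc).1 (Lp.memLp _)
    rw [memLp_const_iff (by simp) (by simp), hinf] at hmem
    have hc0 : c = 0 := by simpa using hmem
    rw [Lp.eq_zero_iff_ae_eq_zero]
    filter_upwards [hc] with x hx
    simp [hx, hc0]
  rw [hp0] at hlim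
  have hlim' := (tendsto_const_nhds (x := f)).inner (𝕜 := ℝ) hlim
  rw [inner_zero_right] at hlim'
  -- Truncation by 1 covers the case `ε = ∞` and gives a positive real lower bound.
  have hεle : min ε 1 ≠ ∞ := by simp
  set δ := (min ε 1).toReal with hδ
  have hδ0 : 0 < δ := ENNReal.toReal_pos (by simp [hε]) hεle
  have hlow : ∀ n > M, δ ≤ inner ℝ f (U^[n] f) := by
    intro n hn
    rw [hinner]
    exact ENNReal.toReal_mono (measure_ne_top_of_subset inter_subset_left hBfin)
      ((min_le_left _ _).trans (hcon n hn))
  have hnn : ∀ n, 0 ≤ inner ℝ f (U^[n] f) := fun n => by rw [hinner]; positivity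
  -- Once `N ≥ 2 * (M + 1)`, at least half of the terms in the average are at least `δ`, while the
  -- averages must tend to zero.
  have hev : ∀ᶠ N : ℕ in atTop, δ / 2 ≤ inner ℝ f
      (birkhoffAverage ℝ U.toContinuousLinearMap id N f) := by
    filter_upwards [eventually_ge_atTop (2 * (M + 1))] with N hN
    have hNpos : (0 : ℝ) < N := by
      have : 0 < N := by omega
      exact_mod_cast this
    have hsum : (N - (M + 1) : ℝ) * δ ≤ ∑ n ∈ Finset.range N, inner ℝ f (U^[n] f) := by
      have : ∑ n ∈ Finset.Ico (M + 1) N, δ ≤ ∑ n ∈ Finset.range N, inner ℝ f (U^[n] f) := by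
        refine (Finset.sum_le_sum fun n hn => hlow n ?_).trans
          (Finset.sum_le_sum_of_subset_of_nonneg ?_ fun n _ _ => hnn n)
        · have := (Finset.mem_Ico.1 hn).1; omega
        · intro n hn
          exact Finset.mem_range.2 (Finset.mem_Ico.1 hn).2
      rw [Finset.sum_const, Nat.card_Ico, nsmul_eq_mul, Nat.cast_sub (by omega)] at this
      simpa using this
    have hN' : (2 * (M + 1) : ℝ) ≤ N := by exact_mod_cast hN
    simp only [birkhoffAverage, birkhoffSum, inner_smul_right, inner_sum]
    rw [inv_mul_eq_div, le_div_iff₀ hNpos]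
    refine le_trans ?_ hsum
    nlinarith
  have := ge_of_tendsto hlim' hev
  linarith

lemma measure_inter_preimage_iter_neg (hT : MeasurePreserving T μ μ) {A : Set X}
    (hA : MeasurableSet A) (k : ℤ) :
    μ (A ∩ iter T (-k) ⁻¹' A) = μ (A ∩ iter T k ⁻¹' A) := by
  rw [← (measurePreserving_iter T hT k).measure_preimage
    (hA.inter (measurable_iter T _ hA)).nullMeasurableSet]
  congr 1
  ext x
  simp [and_comm]

/-- Windows of arbitrary width around large times along which `A` is nearly disjoint from its
translates. -/
lemma exists_window_measure_inter_le (herg : Ergodic T μ) (hinf : μ univ = ∞) {A : Set X}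
    (hA : MeasurableSet A) (hAfin : μ A ≠ ∞) {ε : ℝ≥0∞} (hε : ε ≠ 0) (J : ℕ) :
    ∃ h : ℕ, J < h ∧ ∀ c : ℤ, |(|c|) - h| ≤ J → μ (A ∩ iter T c ⁻¹' A) ≤ ε := by
  have hT := herg.toMeasurePreserving
  -- Thickening `A` by all shifts up to `J` lets a single time `h` for `B` control every `c` within
  -- `J` of `h`.
  set B : Set X := ⋃ j ∈ Finset.Icc (-J : ℤ) J, iter T j ⁻¹' A with hB
  have hBm : MeasurableSet B :=
    Finset.measurableSet_biUnion _ fun j _ => measurable_iter T j hA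
  have hBfin : μ B ≠ ∞ := by
    refine ((measure_biUnion_finset_le _ _).trans_lt ?_).ne
    refine ENNReal.sum_lt_top.2 fun j _ => ?_
    rw [(measurePreserving_iter T hT j).measure_preimage hA.nullMeasurableSet]
    exact hAfin.lt_top
  obtain ⟨h, hJ, hlt⟩ := exists_measure_inter_preimage_iterate_lt T herg hinf hBm hBfin hε J
  refine ⟨h, hJ, ?_⟩
  have key : ∀ c : ℤ, |c - h| ≤ J → μ (A ∩ iter T c ⁻¹' A) ≤ ε := by
    intro c hc
    refine (measure_mono ?_).trans hlt.le
    rintro x ⟨hx, hcx⟩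
    refine ⟨?_, ?_⟩
    · exact mem_biUnion (x := (0 : ℤ)) (by simp) hx
    · refine mem_biUnion (x := c - h) (by simpa [abs_le] using hc) ?_
      change iter T (c - h) (T^[h] x) ∈ A
      rw [← iter_natCast, ← iter_add]
      simpa using hcx
  intro c hc
  rcases abs_cases c with ⟨h1, _⟩ | ⟨h1, _⟩
  · exact key c (by rwa [h1] at hc)
  · rw [← measure_inter_preimage_iter_neg T hT hA]
    exact key (-c) (by rwa [h1] at hc)

end Iterates

/-! ### Freeness of the action and absence of atoms -/

section Aperiodic

variable {X : Type*} [MetricSpace X] [TopologicalSpace.SeparableSpace X]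
  [MeasurableSpace X] [BorelSpace X] {μ : Measure X} (T : X ≃ᵐ X)

lemma sigmaFinite_of_boundedlyFinite (hμ : BoundedlyFinite μ) : SigmaFinite μ := by
  rcases isEmpty_or_nonempty X with hX | ⟨⟨x₀⟩⟩
  · rw [Measure.eq_zero_of_isEmpty μ]; infer_instance
  · exact ⟨⟨⟨fun n => Metric.ball x₀ n, fun _ => trivial,
      fun n => hμ _ Metric.isOpen_ball.measurableSet Metric.isBounded_ball,
      Metric.iUnion_ball_nat x₀⟩⟩⟩

/-- The fixed points of `T^k` form an invariant set, null or conull. If conull, all multiples of `k`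
act trivially a.e.; since every window of width `|k|` contains such a multiple, no set of positive
finite measure could be half-disjoint from its translates there. -/
lemma ae_iter_ne_self [SigmaFinite μ] (herg : Ergodic T μ) (hinf : μ univ = ∞) :
    ∀ᵐ x ∂μ, ∀ k : ℤ, k ≠ 0 → iter T k x ≠ x := by
  have := UniformSpace.secondCountable_of_separable X
  have hT := herg.toMeasurePreserving
  rw [ae_all_iff]
  intro k
  rw [Filter.eventually_imp_distrib_left]
  intro hk
  set E : Set X := {x | iter T k x = x} with hE
  have hEm : MeasurableSet E := measurableSet_eq_fun (measurable_iter T k) measurable_id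
  have hinv : T ⁻¹' E = E := by
    ext x
    simp only [hE, mem_preimage, mem_ofPred_eq, iter_comm]
    exact T.injective.eq_iff
  rcases herg.measure_self_or_compl_eq_zero hEm hinv with hnull | hnull
  · exact measure_eq_zero_iff_ae_notMem.1 hnull
  exfalso
  have hper : ∀ x ∈ E, ∀ n : ℕ, iter T (n * k) x = x := by
    intro x hx n
    induction n with
    | zero => simp
    | succ n ih => rw [Nat.cast_succ, add_one_mul, iter_add, hx, ih]
  obtain ⟨A, -, hA, hA0, hAfin⟩ : ∃ A ⊆ univ, MeasurableSet A ∧ μ A ≠ 0 ∧ μ A ≠ ∞ := by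
    obtain ⟨A, hAs, hA, h1, h2⟩ := Measure.exists_subset_measure_lt_top (μ := μ) (r := 0)
      MeasurableSet.univ (by simp [hinf])
    exact ⟨A, subset_univ _, hAs, h1.ne', h2.ne⟩
  obtain ⟨h, hJ, hw⟩ := exists_window_measure_inter_le T herg hinf hA hAfin
    (ε := μ A / 2) (by simpa using hA0) k.natAbs
  have hle := hw ((h / k.natAbs : ℕ) * k) (by
    rw [abs_mul, Int.abs_eq_natAbs k]
    have h1 := Nat.div_add_mod h k.natAbs
    have h2 := Nat.mod_lt h (Int.natAbs_pos.2 hk)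
    set q := h / k.natAbs
    rw [Nat.abs_cast]
    have h3 : ((q : ℤ) * (k.natAbs : ℤ)) = h - (h % k.natAbs : ℕ) := by
      have : ((k.natAbs * q + h % k.natAbs : ℕ) : ℤ) = h := by exact_mod_cast h1
      push_cast at this ⊢
      linarith
    rw [h3]
    simp only [sub_sub_cancel_left, abs_neg, Nat.abs_cast]
    exact_mod_cast h2.le)
  have hsub : A ∩ E ⊆ A ∩ iter T ((h / k.natAbs : ℕ) * k) ⁻¹' A := by
    rintro x ⟨hx, hxE⟩
    exact ⟨hx, by rw [mem_preimage, hper x hxE]; exact hx⟩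
  have hAE : μ (A ∩ E) = μ A := measure_inter_conull hnull
  have := (hAE.symm.le.trans (measure_mono hsub)).trans hle
  exact absurd (ENNReal.half_lt_self hA0 hAfin) (not_lt.2 this)

/-- By conservativity an atom would return to itself, hence be periodic, but periodic points are
null. -/
lemma measure_singleton_eq_zero [SigmaFinite μ] (hcons : Conservative T μ) (herg : Ergodic T μ)
    (hinf : μ univ = ∞) (x : X) : μ {x} = 0 := by
  by_contra hx
  obtain ⟨y, hy, m, hm, hmy⟩ := hcons.exists_mem_iterate_mem' (measurableSet_singleton x) hx
  rw [mem_singleton_iff] at hy hmy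
  subst hy
  have h := ae_iter_ne_self T herg hinf
  have hy : ∀ k : ℤ, k ≠ 0 → iter T k y ≠ y := by
    by_contra hcon
    exact hx (measure_mono_null (singleton_subset_iff.2 hcon) h)
  exact hy m (by exact_mod_cast hm) (by rw [iter_natCast, hmy])

end Aperiodic

end TPoint

namespace TPoint

open Filter Topology

/-! ### Coin flips coupled with displacements along orbits -/

section Moves

/-- The fair coin on `Bool`. -/
noncomputable def coin : Measure Bool := (2 : ℝ≥0∞)⁻¹ • (Measure.dirac true + Measure.dirac false)

instance : IsProbabilityMeasure coin := ⟨by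
  simp [coin, ENNReal.inv_two_add_inv_two]⟩

lemma map_xor_coin (b : Bool) : coin.map (xor b) = coin := by
  rw [coin, Measure.map_smul, Measure.map_add _ _ (measurable_of_countable _),
    Measure.map_dirac' (measurable_of_countable _), Measure.map_dirac' (measurable_of_countable _)]
  cases b
  · simp
  · simp [add_comm]

/-- Infinitely many independent fair coins. -/
noncomputable def coins : Measure (ℕ → Bool) := Measure.infinitePi fun _ => coin

instance : IsProbabilityMeasure coins := by unfold coins; infer_instance

/-- Flip the coins whose index belongs to `F`. -/
def flip (F : Finset ℕ) (w : ℕ → Bool) : ℕ → Bool := fun i => xor (decide (i ∈ F)) (w i)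

lemma measurable_flip (F : Finset ℕ) : Measurable (flip F) :=
  measurable_pi_lambda _ fun i => (measurable_of_countable _).comp (measurable_pi_apply i)

lemma measurePreserving_flip (F : Finset ℕ) : MeasurePreserving (flip F) coins coins := by
  refine ⟨measurable_flip F, ?_⟩
  have h := Measure.infinitePi_map_pi (μ := fun _ : ℕ => coin)
    (f := fun i => xor (decide (i ∈ F))) (fun i => measurable_of_countable _)
  simp only [map_xor_coin] at h
  exact h

lemma flip_flip (F G : Finset ℕ) (w : ℕ → Bool) : flip F (flip G w) = flip (symmDiff F G) w := by
  ext i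
  by_cases hF : i ∈ F <;> by_cases hG : i ∈ G <;> simp [flip, Finset.mem_symmDiff, hF, hG]

/-- The displacement along the orbit which is produced by flipping the coins of `F`. -/
def disp (h : ℕ → ℕ) (F : Finset ℕ) (w : ℕ → Bool) : ℤ :=
  ∑ i ∈ F, if w i then -(h i : ℤ) else h i

variable {h : ℕ → ℕ}

lemma measurable_disp (h : ℕ → ℕ) (F : Finset ℕ) : Measurable (disp h F) :=
  Finset.measurable_fun_sum _ fun i _ =>
    (measurable_of_countable fun b : Bool => if b then -(h i : ℤ) else h i).comp
      (measurable_pi_apply i)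

@[simp] lemma disp_empty (w : ℕ → Bool) : disp h ∅ w = 0 := rfl

lemma disp_insert {n : ℕ} {F : Finset ℕ} (hn : n ∉ F) (w : ℕ → Bool) :
    disp h (insert n F) w = (if w n then -(h n : ℤ) else h n) + disp h F w :=
  Finset.sum_insert hn

/-- The cocycle identity: a coin in both `F` and `G` is flipped twice, and its displacements cancel
because the sign reads the current value of the coin. It makes `move` a group action. -/
lemma disp_flip_add_disp (F G : Finset ℕ) (w : ℕ → Bool) :
    disp h F (flip G w) + disp h G w = disp h (symmDiff F G) w := by
  have key : ∀ (E : Finset ℕ) (v : ℕ → Bool), E ⊆ F ∪ G → disp h E v =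
      ∑ i ∈ F ∪ G, if i ∈ E then (if v i then -(h i : ℤ) else h i) else 0 := by
    intro E v hE
    rw [Finset.sum_ite_mem, Finset.inter_eq_right.2 hE]
    rfl
  rw [key F _ Finset.subset_union_left, key G _ Finset.subset_union_right,
    key (symmDiff F G) _ symmDiff_le_sup, ← Finset.sum_add_distrib]
  refine Finset.sum_congr rfl fun i _ => ?_
  by_cases hF : i ∈ F <;> by_cases hG : i ∈ G <;> cases hw : w i <;>
    simp [flip, Finset.mem_symmDiff, hF, hG, hw]

lemma abs_disp_le {n : ℕ} {F : Finset ℕ} (hF : F ⊆ Finset.range n) (w : ℕ → Bool) :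
    |disp h F w| ≤ (∑ i ∈ Finset.range n, h i : ℕ) := by
  refine (Finset.abs_sum_le_sum_abs _ _).trans ?_
  push_cast
  refine (Finset.sum_le_sum_of_subset_of_nonneg hF fun _ _ _ => abs_nonneg _).trans_eq ?_
  refine Finset.sum_congr rfl fun i _ => ?_
  split_ifs <;> simp

/-- The largest index dominates the displacement; the error is exactly the window width allowed in
the choice of `h n`. -/
lemma abs_abs_disp_insert_sub_le {n : ℕ} {F : Finset ℕ} (hF : F ⊆ Finset.range n) (w : ℕ → Bool) :
    |(|disp h (insert n F) w|) - h n| ≤ (∑ i ∈ Finset.range n, h i : ℕ) := by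
  have hn : n ∉ F := fun hn => absurd (hF hn) (by simp)
  refine le_trans ?_ (abs_disp_le hF w)
  rw [disp_insert hn]
  have h1 : (h n : ℤ) = |if w n then -(h n : ℤ) else h n| := by split_ifs <;> simp
  conv_lhs => rw [h1]
  refine (abs_abs_sub_abs_le _ _).trans ?_
  rw [← h1]
  simp

lemma disp_ne_zero (hh : ∀ n, ∑ i ∈ Finset.range n, h i < h n) {F : Finset ℕ} (hF : F ≠ ∅)
    (w : ℕ → Bool) : disp h F w ≠ 0 := by
  have hne := Finset.nonempty_iff_ne_empty.2 hF
  set n := F.max' hne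
  have hF' : F.erase n ⊆ Finset.range n := by
    intro i hi
    rw [Finset.mem_range]
    exact lt_of_le_of_ne (F.le_max' i (Finset.mem_of_mem_erase hi)) (Finset.ne_of_mem_erase hi)
  have hle := abs_abs_disp_insert_sub_le (h := h) hF' w
  rw [Finset.insert_erase (F.max'_mem hne)] at hle
  intro h0
  rw [h0] at hle
  have := hh n
  simp only [abs_zero, zero_sub, abs_neg, Nat.abs_cast] at hle
  omega

variable {X : Type*} [MeasurableSpace X] (T : X ≃ᵐ X) {μ : Measure X}

/-- Flip the coins of `F` and move along the orbit accordingly. -/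
def move (h : ℕ → ℕ) (F : Finset ℕ) (y : (ℕ → Bool) × X) : (ℕ → Bool) × X :=
  (flip F y.1, iter T (disp h F y.1) y.2)

lemma move_move (F G : Finset ℕ) (y : (ℕ → Bool) × X) :
    move T h F (move T h G y) = move T h (symmDiff F G) y := by
  simp only [move, flip_flip, ← disp_flip_add_disp, iter_add]

lemma move_empty (y : (ℕ → Bool) × X) : move T h ∅ y = y := by
  simp only [move, disp_empty, iter_zero]
  refine Prod.ext ?_ rfl
  ext i
  simp [flip]

lemma move_self_move (F : Finset ℕ) (y : (ℕ → Bool) × X) :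
    move T h F (move T h F y) = y := by
  rw [move_move, symmDiff_self]
  exact move_empty T y

lemma measurable_uncurry_iter : Measurable fun p : ℤ × X => iter T p.1 p.2 :=
  measurable_from_prod_countable_right fun k => measurable_iter T k

lemma measurable_move (F : Finset ℕ) : Measurable (move T h F) :=
  ((measurable_flip F).comp measurable_fst).prodMk
    ((measurable_uncurry_iter T).comp
      (((measurable_disp h F).comp measurable_fst).prodMk measurable_snd))

lemma measurePreserving_move [SFinite μ] (hT : MeasurePreserving T μ μ) (F : Finset ℕ) :
    MeasurePreserving (move T h F) (coins.prod μ) (coins.prod μ) :=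
  (measurePreserving_flip F).skew_product (g := fun w x => iter T (disp h F w) x)
    ((measurable_uncurry_iter T).comp
      (((measurable_disp h F).comp measurable_fst).prodMk measurable_snd))
    (ae_of_all _ fun _ => (measurePreserving_iter T hT _).map_eq)

/-- Mass transport: each move is a measure-preserving involution. -/
lemma lintegral_comp_move_mul [SFinite μ] (hT : MeasurePreserving T μ μ) (F : Finset ℕ)
    {f g : (ℕ → Bool) × X → ℝ≥0∞} (hf : Measurable f) (hg : Measurable g) :
    ∫⁻ y, f (move T h F y) * g y ∂(coins.prod μ) =
      ∫⁻ y, f y * g (move T h F y) ∂(coins.prod μ) := by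
  rw [← (measurePreserving_move (h := h) T hT F).lintegral_comp
    (f := fun y => f y * g (move T h F y)) (hf.mul (hg.comp (measurable_move T F)))]
  simp only [move_self_move]

lemma tsum_move_move (f : (ℕ → Bool) × X → ℝ≥0∞) (G : Finset ℕ) (y : (ℕ → Bool) × X) :
    ∑' F, f (move T h F (move T h G y)) = ∑' F, f (move T h F y) := by
  simp only [move_move]
  exact (Equiv.ofBijective (fun F : Finset ℕ => symmDiff F G)
    (symmDiff_left_involutive G).bijective).tsum_eq fun F => f (move T h F y)

/-- Weights that sum up to one on the classes of `move` give the same integral to functions that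
are constant on the classes. -/
lemma lintegral_mul_weight_eq [SFinite μ] (hT : MeasurePreserving T μ μ)
    {H g g' : (ℕ → Bool) × X → ℝ≥0∞} (hH : Measurable H) (hg : Measurable g) (hg' : Measurable g')
    (hinv : ∀ F y, H (move T h F y) = H y)
    (h1 : ∀ᵐ y ∂(coins.prod μ), ∑' F, g (move T h F y) = 1)
    (h1' : ∀ᵐ y ∂(coins.prod μ), ∑' F, g' (move T h F y) = 1) :
    ∫⁻ y, H y * g y ∂(coins.prod μ) = ∫⁻ y, H y * g' y ∂(coins.prod μ) := by
  -- Insert the factor `∑' F, g' (move T h F y) = 1`, transport each term by its involution, and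
  -- resum the translates of `g` to one.
  calc ∫⁻ y, H y * g y ∂(coins.prod μ)
      = ∫⁻ y, ∑' F, g' (move T h F y) * (H y * g y) ∂(coins.prod μ) := by
        refine lintegral_congr_ae ?_
        filter_upwards [h1'] with y hy
        rw [ENNReal.tsum_mul_right, hy, one_mul]
    _ = ∑' F, ∫⁻ y, g' (move T h F y) * (H y * g y) ∂(coins.prod μ) :=
        lintegral_tsum fun F =>
          ((hg'.comp (measurable_move T F)).mul (hH.mul hg)).aemeasurable
    _ = ∑' F, ∫⁻ y, g (move T h F y) * (H y * g' y) ∂(coins.prod μ) := by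
        refine tsum_congr fun F => ?_
        rw [lintegral_comp_move_mul T hT F (g := fun y => H y * g y) hg' (hH.mul hg)]
        simp only [hinv]
        refine lintegral_congr fun y => by ring
    _ = ∫⁻ y, ∑' F, g (move T h F y) * (H y * g' y) ∂(coins.prod μ) :=
        (lintegral_tsum fun F =>
          ((hg.comp (measurable_move T F)).mul (hH.mul hg')).aemeasurable).symm
    _ = ∫⁻ y, H y * g' y ∂(coins.prod μ) := by
        refine lintegral_congr_ae ?_
        filter_upwards [h1] with y hy
        rw [ENNReal.tsum_mul_right, hy, one_mul]

/-! ### Clusters and their mean -/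

/-- The counting measure on the positions of the class of `y`. -/
noncomputable def cluster (h : ℕ → ℕ) (y : (ℕ → Bool) × X) : Measure X :=
  Measure.sum fun F : Finset ℕ => Measure.dirac (move T h F y).2

lemma lintegral_cluster {f : X → ℝ≥0∞} (hf : Measurable f) (y : (ℕ → Bool) × X) :
    ∫⁻ x, f x ∂(cluster T h y) = ∑' F, f (move T h F y).2 := by
  simp only [cluster, lintegral_sum_measure, lintegral_dirac' _ hf]

lemma cluster_apply {A : Set X} (hA : MeasurableSet A) (y : (ℕ → Bool) × X) :
    cluster T h y A = ∑' F, A.indicator 1 (move T h F y).2 := by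
  rw [← lintegral_indicator_one hA, lintegral_cluster T (measurable_one.indicator hA)]

lemma measurable_cluster : Measurable (cluster T h) := by
  refine Measure.measurable_of_measurable_coe _ fun A hA => ?_
  simp only [cluster_apply T hA]
  exact Measurable.tsum fun F =>
    (measurable_one.indicator hA).comp (measurable_snd.comp (measurable_move T F))

lemma lintegral_cluster_move {f : X → ℝ≥0∞} (hf : Measurable f) (G : Finset ℕ)
    (y : (ℕ → Bool) × X) :
    ∫⁻ x, f x ∂(cluster T h (move T h G y)) = ∫⁻ x, f x ∂(cluster T h y) := by
  rw [lintegral_cluster T hf, lintegral_cluster T hf,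
    tsum_move_move T (fun y => f y.2)]

lemma move_snd_apply (F : Finset ℕ) (w : ℕ → Bool) (x : X) :
    move T h F (w, T x) = ((move T h F (w, x)).1, T (move T h F (w, x)).2) := by
  simp [move, iter_comm]

lemma lintegral_cluster_apply_snd {f : X → ℝ≥0∞} (hf : Measurable f) (w : ℕ → Bool) (x : X) :
    ∫⁻ z, f z ∂(cluster T h (w, T x)) = ∫⁻ z, f (T z) ∂(cluster T h (w, x)) := by
  rw [lintegral_cluster T hf, lintegral_cluster T (f := fun z => f (T z)) (hf.comp T.measurable)]
  simp only [move_snd_apply]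

/-- The mean of the cluster measures with respect to a weight. -/
lemma lintegral_cluster_mul_weight [SFinite μ] (hT : MeasurePreserving T μ μ)
    {g : (ℕ → Bool) × X → ℝ≥0∞} (hg : Measurable g)
    (h1 : ∀ᵐ y ∂(coins.prod μ), ∑' F, g (move T h F y) = 1) {A : Set X} (hA : MeasurableSet A) :
    ∫⁻ y, cluster T h y A * g y ∂(coins.prod μ) = μ A := by
  have hind : Measurable fun y : (ℕ → Bool) × X => A.indicator (1 : X → ℝ≥0∞) y.2 :=
    (measurable_one.indicator hA).comp measurable_snd
  calc ∫⁻ y, cluster T h y A * g y ∂(coins.prod μ)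
      = ∑' F, ∫⁻ y, A.indicator 1 (move T h F y).2 * g y ∂(coins.prod μ) := by
        simp only [cluster_apply T hA, ← ENNReal.tsum_mul_right]
        exact lintegral_tsum fun F =>
          ((hind.comp (measurable_move T F)).mul hg).aemeasurable
    _ = ∑' F, ∫⁻ y, A.indicator 1 y.2 * g (move T h F y) ∂(coins.prod μ) :=
        tsum_congr fun F => lintegral_comp_move_mul T hT F hind hg
    _ = ∫⁻ y, A.indicator 1 y.2 * ∑' F, g (move T h F y) ∂(coins.prod μ) := by
        simp only [← ENNReal.tsum_mul_left]
        exact (lintegral_tsum fun F =>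
          (hind.mul (hg.comp (measurable_move T F))).aemeasurable).symm
    _ = ∫⁻ y, (univ ×ˢ A).indicator 1 y ∂(coins.prod μ) := by
        refine lintegral_congr_ae ?_
        filter_upwards [h1] with y hy
        rw [hy, mul_one]
        by_cases hyA : y.2 ∈ A <;> simp [hyA]
    _ = μ A := by
        rw [lintegral_indicator_one (MeasurableSet.univ.prod hA), Measure.prod_prod,
          measure_univ, one_mul]

lemma cluster_orbit [MeasurableSingletonClass X] (y : (ℕ → Bool) × X) :
    cluster T h y (orbit T y.2) = ∞ := by
  rw [cluster_apply T (countable_orbit T _).measurableSet]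
  have : ∀ F, (orbit T y.2).indicator (1 : X → ℝ≥0∞) (move T h F y).2 = 1 := fun F =>
    indicator_of_mem (show (move T h F y).2 ∈ orbit T y.2 from ⟨disp h F y.1, rfl⟩) _
  simp only [this]
  exact ENNReal.tsum_const_eq_top_of_ne_zero one_ne_zero

/-- Two coinciding positions differ by the displacement of a nonempty symmetric difference, which is
nonzero by sparsity; a free orbit excludes this. -/
lemma injective_move_snd (hh : ∀ n, ∑ i ∈ Finset.range n, h i < h n) {y : (ℕ → Bool) × X}
    (hy : ∀ k : ℤ, k ≠ 0 → iter T k y.2 ≠ y.2) :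
    Function.Injective fun F => (move T h F y).2 := by
  intro F G hFG
  by_contra hne
  have hs : symmDiff F G ≠ ∅ := fun h0 => hne (symmDiff_eq_bot.1 h0)
  have h0 := disp_ne_zero hh hs (flip G y.1)
  have heq : (move T h (symmDiff F G) (move T h G y)).2 = (move T h G y).2 := by
    rw [move_move, symmDiff_assoc, symmDiff_self, symmDiff_bot]
    exact hFG
  refine hy _ h0 ?_
  apply iter_injective T (disp h G y.1)
  rw [← iter_add, add_comm, iter_add]
  exact heq

/-! ### Sparse times and normalised weights -/

/-- A summability criterion along finite sets of integers, listed by their largest element. -/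
lemma tsum_finset_nat_le {u : Finset ℕ → ℝ≥0∞} {a : ℝ≥0∞} {K : ℕ} (ha : ∀ F, u F ≤ a)
    (hu : ∀ n ≥ K, ∀ F ⊆ Finset.range n, u (insert n F) ≤ 4⁻¹ ^ n) :
    ∑' F, u F ≤ 2 ^ K * a + 2 := by
  -- The `2 ^ n` sets with largest element `n` contribute at most `2 ^ n * 4⁻¹ ^ n = 2⁻¹ ^ n`; the
  -- `2 ^ K` subsets of `range K` are bounded by `a` each.
  have key : ∀ n, ∑ F ∈ (Finset.range n).powerset, u F ≤
      2 ^ K * a + ∑ i ∈ Finset.range n, (2 : ℝ≥0∞)⁻¹ ^ i := by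
    intro n
    induction n with
    | zero =>
      have : a ≤ 2 ^ K * a := le_mul_of_one_le_left' (one_le_pow₀ one_le_two)
      simpa using (ha ∅).trans this
    | succ n ih =>
      rcases lt_or_ge n K with hn | hn
      · refine le_add_right ?_
        refine (Finset.sum_le_card_nsmul _ _ a fun F _ => ha F).trans ?_
        rw [Finset.card_powerset, Finset.card_range, nsmul_eq_mul]
        gcongr
        push_cast
        exact pow_le_pow_right₀ one_le_two hn
      · rw [Finset.range_add_one, Finset.sum_powerset_insert (by simp),
          Finset.sum_insert (by simp), add_comm ((2 : ℝ≥0∞)⁻¹ ^ n), ← add_assoc]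
        refine add_le_add ih ?_
        refine (Finset.sum_le_card_nsmul _ _ _
          fun F hF => hu n hn F (Finset.mem_powerset.1 hF)).trans_eq ?_
        rw [Finset.card_powerset, Finset.card_range, nsmul_eq_mul]
        push_cast
        rw [← mul_pow]
        congr 1
        rw [show (4 : ℝ≥0∞) = 2 * 2 by norm_num,
          ENNReal.mul_inv (by simp) (by simp), ← mul_assoc,
          ENNReal.mul_inv_cancel (by simp) (by simp), one_mul]
  rw [ENNReal.tsum_eq_iSup_sum' (fun n : ℕ => (Finset.range n).powerset)]
  · refine iSup_le fun n => (key n).trans ?_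
    gcongr
    exact (ENNReal.sum_le_tsum _).trans_eq ENNReal.tsum_geometric_two
  · intro s
    refine ⟨(s.sup id).sup id + 1, fun F hF => ?_⟩
    rw [Finset.mem_powerset]
    intro i hi
    rw [Finset.mem_range, Nat.lt_succ_iff]
    exact Finset.le_sup (f := id) (Finset.le_sup (f := id) hF hi)

/-- A sequence of sets of finite measure admits a sequence of very sparse times. -/
lemma exists_sparse_times (herg : Ergodic T μ) (hinf : μ univ = ∞) {A : ℕ → Set X}
    (hA : ∀ n, MeasurableSet (A n)) (hAfin : ∀ n, μ (A n) ≠ ∞) :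
    ∃ h : ℕ → ℕ, ∀ n, ∑ i ∈ Finset.range n, h i < h n ∧
      ∀ c : ℤ, |(|c|) - h n| ≤ (∑ i ∈ Finset.range n, h i : ℕ) →
        μ (A n ∩ iter T c ⁻¹' A n) ≤ 4⁻¹ ^ n := by
  have hε : ∀ n : ℕ, (4⁻¹ : ℝ≥0∞) ^ n ≠ 0 := fun n => pow_ne_zero _ (by simp)
  choose H hH using fun n => exists_window_measure_inter_le T herg hinf (hA n) (hAfin n) (hε n)
  -- `J n` is the sum of the times already chosen, used as the window width for the next one.
  let J : ℕ → ℕ := fun n => Nat.rec 0 (fun n j => j + H n j) n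
  have hJ : ∀ n, ∑ i ∈ Finset.range n, H i (J i) = J n := by
    intro n
    induction n with
    | zero => rfl
    | succ n ih => rw [Finset.sum_range_succ, ih]
  refine ⟨fun n => H n (J n), fun n => ?_⟩
  simp only [hJ]
  exact hH n (J n)

/-- Along sparse times there is a weight which sums up to one on almost every class of `move`. -/
lemma exists_weight [SigmaFinite μ] {A : ℕ → Set X}
    (hA : ∀ n, MeasurableSet (A n)) (hAfin : ∀ n, μ (A n) ≠ ∞) (hmono : Monotone A)
    (hun : ⋃ n, A n = univ)
    (hh : ∀ n, ∀ c : ℤ, |(|c|) - h n| ≤ (∑ i ∈ Finset.range n, h i : ℕ) →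
        μ (A n ∩ iter T c ⁻¹' A n) ≤ 4⁻¹ ^ n) :
    ∃ g : (ℕ → Bool) × X → ℝ≥0∞, Measurable g ∧
      ∀ᵐ y ∂(coins.prod μ), ∑' F, g (move T h F y) = 1 := by
  -- A strictly positive function; the factors `4⁻¹ ^ m` beat the growth `2 ^ m` in the bound
  -- `hsum`. Its class sum `Φ` will be finite a.e., and the weight is `φ / Φ`.
  set φ : X → ℝ≥0∞ := fun x => ∑' m, 4⁻¹ ^ m * (A m).indicator 1 x with hφ
  have hφm : Measurable φ := Measurable.tsum fun m =>
    (measurable_one.indicator (hA m)).const_mul _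
  have hφ0 : ∀ x, φ x ≠ 0 := by
    intro x h0
    obtain ⟨m, hm⟩ := mem_iUnion.1 (hun.symm.subset (mem_univ x))
    have := ENNReal.tsum_eq_zero.1 h0 m
    simp [hm] at this
  set Φ : (ℕ → Bool) × X → ℝ≥0∞ := fun y => ∑' F, φ (move T h F y).2 with hΦ
  have hΦm : Measurable Φ := Measurable.tsum fun F =>
    hφm.comp (measurable_snd.comp (measurable_move T F))
  have hΦinv : ∀ F y, Φ (move T h F y) = Φ y := fun F y =>
    tsum_move_move T (fun y => φ y.2) F y
  have hsum : ∀ k m w, ∑' F, μ (A k ∩ iter T (disp h F w) ⁻¹' A m) ≤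
      2 ^ (max k m) * μ (A k) + 2 := by
    intro k m w
    refine tsum_finset_nat_le (fun F => measure_mono inter_subset_left) fun n hn F hF => ?_
    refine (measure_mono ?_).trans (hh n _ (abs_abs_disp_insert_sub_le hF w))
    exact inter_subset_inter (hmono ((le_max_left _ _).trans hn))
      (preimage_mono (hmono ((le_max_right _ _).trans hn)))
  -- The bound is uniform in the coins, so integrating over them costs nothing; finiteness on each
  -- `A k` gives `Φ < ∞` a.e.
  have hint : ∀ k, ∫⁻ y, (A k).indicator 1 y.2 * Φ y ∂(coins.prod μ) ≠ ∞ := by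
    intro k
    have hbound : ∀ w, ∫⁻ x, (A k).indicator 1 x * Φ (w, x) ∂μ ≤
        ∑' m : ℕ, (4⁻¹ ^ m * (2 ^ (k + m) * μ (A k) + 2)) := by
      intro w
      have hterm : ∀ m F, Measurable fun x =>
          4⁻¹ ^ m * (A k ∩ iter T (disp h F w) ⁻¹' A m).indicator (1 : X → ℝ≥0∞) x :=
        fun m F => (measurable_one.indicator
          ((hA k).inter (measurable_iter T _ (hA m)))).const_mul _
      calc ∫⁻ x, (A k).indicator 1 x * Φ (w, x) ∂μ
          = ∫⁻ x, ∑' m, ∑' F, 4⁻¹ ^ m *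
              (A k ∩ iter T (disp h F w) ⁻¹' A m).indicator 1 x ∂μ := by
            refine lintegral_congr fun x => ?_
            simp only [hΦ, hφ]
            rw [ENNReal.tsum_comm, ← ENNReal.tsum_mul_left]
            refine tsum_congr fun m => ?_
            rw [← ENNReal.tsum_mul_left]
            refine tsum_congr fun F => ?_
            by_cases h1 : x ∈ A k <;> by_cases h2 : iter T (disp h F w) x ∈ A m <;>
              simp [move, indicator, h1, h2]
        _ = ∑' m : ℕ, 4⁻¹ ^ m * ∑' F, μ (A k ∩ iter T (disp h F w) ⁻¹' A m) := by
            rw [lintegral_tsum fun m => (Measurable.tsum (hterm m)).aemeasurable]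
            refine tsum_congr fun m => ?_
            rw [lintegral_tsum fun F => (hterm m F).aemeasurable, ← ENNReal.tsum_mul_left]
            refine tsum_congr fun F => ?_
            have hms := (hA k).inter (measurable_iter T (disp h F w) (hA m))
            rw [lintegral_const_mul _ (measurable_one.indicator hms), lintegral_indicator_one hms]
        _ ≤ _ := by
            refine ENNReal.tsum_le_tsum fun m => ?_
            gcongr
            refine (hsum k m w).trans ?_
            gcongr
            · exact one_le_two
            · omega
    have hfin : ∑' m : ℕ, ((4⁻¹ : ℝ≥0∞) ^ m * (2 ^ (k + m) * μ (A k) + 2)) ≠ ∞ := by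
      have hle : ∑' m : ℕ, ((4⁻¹ : ℝ≥0∞) ^ m * (2 ^ (k + m) * μ (A k) + 2)) ≤
          (2 ^ k * μ (A k) + 2) * 2 := by
        refine (ENNReal.tsum_le_tsum (g := fun m => (2 ^ k * μ (A k) + 2) * 2⁻¹ ^ m)
          fun m => ?_).trans_eq (by rw [ENNReal.tsum_mul_left, ENNReal.tsum_geometric_two])
        have h42 : (4⁻¹ : ℝ≥0∞) ^ m * 2 ^ m = 2⁻¹ ^ m := by
          rw [← mul_pow, show (4 : ℝ≥0∞) = 2 * 2 by norm_num,
            ENNReal.mul_inv (by simp) (by simp), mul_assoc,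
            ENNReal.inv_mul_cancel (by simp) (by simp), mul_one]
        have h4 : (4⁻¹ : ℝ≥0∞) ^ m ≤ 2⁻¹ ^ m := by
          rw [← h42]
          exact le_mul_of_one_le_right' (one_le_pow₀ one_le_two)
        calc (4⁻¹ : ℝ≥0∞) ^ m * (2 ^ (k + m) * μ (A k) + 2)
            = 2 ^ k * μ (A k) * (4⁻¹ ^ m * 2 ^ m) + 2 * 4⁻¹ ^ m := by ring
          _ ≤ 2 ^ k * μ (A k) * 2⁻¹ ^ m + 2 * 2⁻¹ ^ m := by rw [h42]; gcongr
          _ = _ := by ring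
      refine ne_top_of_le_ne_top ?_ hle
      exact ENNReal.mul_ne_top (ENNReal.add_ne_top.2
        ⟨ENNReal.mul_ne_top (by simp) (hAfin k), by simp⟩) (by simp)
    refine ne_top_of_le_ne_top hfin ?_
    rw [lintegral_prod (fun y => (A k).indicator 1 y.2 * Φ y)
      (((measurable_one.indicator (hA k)).comp measurable_snd).mul hΦm).aemeasurable]
    refine (lintegral_mono hbound).trans ?_
    simp
  have hΦfin : ∀ᵐ y ∂(coins.prod μ), Φ y ≠ ∞ := by
    have hall : ∀ᵐ y ∂(coins.prod μ), ∀ k, (A k).indicator 1 y.2 * Φ y < ∞ :=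
      ae_all_iff.2 fun k => ae_lt_top (((measurable_one.indicator (hA k)).comp
        measurable_snd).mul hΦm) (hint k)
    filter_upwards [hall] with y hy
    obtain ⟨m, hm⟩ := mem_iUnion.1 (hun.symm.subset (mem_univ y.2))
    have := hy m
    rw [indicator_of_mem hm] at this
    simpa using this.ne
  refine ⟨fun y => φ y.2 * (Φ y)⁻¹, (hφm.comp measurable_snd).mul hΦm.inv, ?_⟩
  filter_upwards [hΦfin] with y hy
  simp only [hΦinv, ENNReal.tsum_mul_right]
  refine ENNReal.mul_inv_cancel (fun h0 => ?_) hy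
  exact hφ0 _ (ENNReal.tsum_eq_zero.1 h0 ∅)

end Moves

end TPoint

namespace TPoint

open Filter Topology ProbabilityTheory
open scoped NNReal

/-! ### The exponential on `[0, ∞]` -/

section ExpNeg

/-- The function `t ↦ exp (-t)` on `[0, ∞]`. -/
noncomputable def expNeg (t : ℝ≥0∞) : ℝ≥0∞ := EReal.exp (-(t : EReal))

lemma continuous_expNeg : Continuous expNeg :=
  ENNReal.continuous_exp.comp (continuous_neg.comp continuous_coe_ennreal_ereal)

lemma measurable_expNeg : Measurable expNeg := continuous_expNeg.measurable

@[simp] lemma expNeg_zero : expNeg 0 = 1 := by simp [expNeg]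

lemma expNeg_le_one (t : ℝ≥0∞) : expNeg t ≤ 1 := by
  simp [expNeg, EReal.coe_ennreal_nonneg]

lemma expNeg_ne_top (t : ℝ≥0∞) : expNeg t ≠ ∞ := ((expNeg_le_one t).trans_lt ENNReal.one_lt_top).ne

lemma expNeg_add (s t : ℝ≥0∞) : expNeg (s + t) = expNeg s * expNeg t := by
  rw [expNeg, EReal.coe_ennreal_add, EReal.neg_add (by simp) (by simp), sub_eq_add_neg,
    EReal.exp_add]
  rfl

lemma expNeg_sum {ι : Type*} (s : Finset ι) (f : ι → ℝ≥0∞) :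
    expNeg (∑ i ∈ s, f i) = ∏ i ∈ s, expNeg (f i) := by
  classical
  induction s using Finset.induction_on with
  | empty => simp
  | insert a s ha ih => rw [Finset.sum_insert ha, Finset.prod_insert ha, expNeg_add, ih]

lemma expNeg_ofReal {r : ℝ} (hr : 0 ≤ r) :
    expNeg (ENNReal.ofReal r) = ENNReal.ofReal (Real.exp (-r)) := by
  rw [expNeg, EReal.coe_ennreal_ofReal, max_eq_left hr, ← EReal.coe_neg, EReal.exp_coe]

lemma expNeg_injective : Function.Injective expNeg := fun s t h => by
  have h1 := EReal.exp_strictMono.injective h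
  exact EReal.coe_ennreal_injective (neg_injective h1)

end ExpNeg

/-! ### Poisson processes with layered intensity -/

section Poisson

lemma lintegral_pow_poissonMeasure (c : ℝ≥0) {s : ℝ≥0∞} (hs : s ≤ 1) :
    ∫⁻ k, s ^ k ∂(poissonMeasure c) = expNeg (c * (1 - s)) := by
  have hs' : s ≠ ∞ := (hs.trans_lt ENNReal.one_lt_top).ne
  lift s to ℝ≥0 using hs'
  have hs1 : (s : ℝ) ≤ 1 := by exact_mod_cast hs
  have hexp : (c : ℝ≥0∞) * (1 - s) = ENNReal.ofReal (c * (1 - s)) := by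
    rw [ENNReal.ofReal_mul c.coe_nonneg, ENNReal.ofReal_sub _ s.coe_nonneg]
    simp
  rw [hexp, expNeg_ofReal (mul_nonneg c.coe_nonneg (by linarith)), lintegral_countable']
  have hsum : HasSum (fun k : ℕ => Real.exp (-c) * ((c * s : ℝ) ^ k / k.factorial))
      (Real.exp (-c) * Real.exp (c * s)) := by
    refine HasSum.mul_left _ ?_
    rw [Real.exp_eq_exp_ℝ]
    exact NormedSpace.expSeries_div_hasSum_exp (c * s : ℝ)
  rw [show -((c : ℝ) * (1 - s)) = -c + c * s by ring, Real.exp_add, ← hsum.tsum_eq,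
    ENNReal.ofReal_tsum_of_nonneg (fun k => by positivity) hsum.summable]
  refine tsum_congr fun k => ?_
  rw [poissonMeasure_singleton, ← ENNReal.ofReal_coe_nnreal, ← ENNReal.ofReal_pow s.coe_nonneg,
    ← ENNReal.ofReal_mul (by positivity)]
  congr 1
  rw [mul_pow]
  ring

lemma lintegral_natCast_poissonMeasure (c : ℝ≥0) :
    ∫⁻ k, (k : ℝ≥0∞) ∂(poissonMeasure c) = c := by
  rw [lintegral_countable', tsum_eq_zero_add' ENNReal.summable]
  have h : ∀ k : ℕ, ((k + 1 : ℕ) : ℝ≥0∞) * poissonMeasure c {k + 1} =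
      c * poissonMeasure c {k} := by
    intro k
    rw [poissonMeasure_singleton, poissonMeasure_singleton, ← ENNReal.ofReal_natCast,
      ← ENNReal.ofReal_coe_nnreal, ← ENNReal.ofReal_mul (by positivity),
      ← ENNReal.ofReal_mul (by positivity)]
    congr 1
    rw [Nat.factorial_succ]
    push_cast
    field_simp
    ring
  simp only [h, ENNReal.tsum_mul_left, Nat.cast_zero, zero_mul, zero_add]
  have h1 := lintegral_countable' (μ := poissonMeasure c) (fun _ => 1)
  simp only [lintegral_const, measure_univ, mul_one, one_mul] at h1
  rw [← h1, mul_one]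

/-- The potential point `(i, j)` is active when `j` is below the Poisson number of layer `i`; the
index set stays fixed, so a product measure can carry the process. -/
lemma tsum_active_eq (K : ℕ → ℕ) (f : (Σ _ : ℕ, ℕ) → ℝ≥0∞) :
    ∑' p : (Σ _ : ℕ, ℕ), (if p.2 < K p.1 then f p else 0) =
      ∑' i, ∑ j ∈ Finset.range (K i), f ⟨i, j⟩ := by
  rw [ENNReal.tsum_sigma']
  refine tsum_congr fun i => ?_
  rw [tsum_eq_sum (s := Finset.range (K i)) fun j hj => if_neg (by simpa using hj)]
  exact Finset.sum_congr rfl fun j hj => if_pos (Finset.mem_range.1 hj)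

variable {Y : Type*} [MeasurableSpace Y]

lemma measurable_active {F : Y → ℝ≥0∞} (hF : Measurable F) (p : Σ _ : ℕ, ℕ) :
    Measurable fun ω : (ℕ → ℕ) × ((Σ _ : ℕ, ℕ) → Y) =>
      if p.2 < ω.1 p.1 then F (ω.2 p) else 0 := by
  refine Measurable.ite ?_ (by fun_prop) measurable_const
  exact measurableSet_lt measurable_const (by fun_prop)

variable (c : ℕ → ℝ≥0) (π : ℕ → Measure Y)
  [∀ i, IsProbabilityMeasure (π i)]

/-- The law of independent random variables: Poisson numbers of points in the layers, and the
potential points of each layer. -/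
noncomputable def poissonLaw : Measure ((ℕ → ℕ) × ((Σ _ : ℕ, ℕ) → Y)) :=
  (Measure.infinitePi fun i => poissonMeasure (c i)).prod
    (Measure.infinitePi fun p : (Σ _ : ℕ, ℕ) => π p.1)

instance : IsProbabilityMeasure (poissonLaw c π) := by unfold poissonLaw; infer_instance

/-- The Laplace functional of a Poisson process. -/
lemma lintegral_expNeg_poissonLaw {F : Y → ℝ≥0∞} (hF : Measurable F) :
    ∫⁻ ω, expNeg (∑' p : (Σ _ : ℕ, ℕ), if p.2 < ω.1 p.1 then F (ω.2 p) else 0) ∂(poissonLaw c π) =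
      expNeg (∫⁻ y, (1 - expNeg (F y)) ∂(Measure.sum fun i => (c i : ℝ≥0∞) • π i)) := by
  set s : ℕ → ℝ≥0∞ := fun i => ∫⁻ y, expNeg (F y) ∂(π i) with hs
  have heF : Measurable fun y => expNeg (F y) := measurable_expNeg.comp hF
  have hs1 : ∀ i, s i ≤ 1 := fun i => by
    refine (lintegral_mono fun y => expNeg_le_one (F y)).trans ?_
    simp
  have hR : ∫⁻ y, (1 - expNeg (F y)) ∂(Measure.sum fun i => (c i : ℝ≥0∞) • π i) =
      ∑' i, c i * (1 - s i) := by
    rw [lintegral_sum_measure]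
    refine tsum_congr fun i => ?_
    rw [lintegral_smul_measure, lintegral_sub heF ((hs1 i).trans_lt ENNReal.one_lt_top).ne
      (ae_of_all _ fun y => expNeg_le_one _)]
    simp [hs]
  have hmeas : ∀ n, Measurable fun ω : (ℕ → ℕ) × ((Σ _ : ℕ, ℕ) → Y) =>
      expNeg (∑ i ∈ Finset.range n, ∑ j ∈ Finset.range (ω.1 i), F (ω.2 ⟨i, j⟩)) := by
    refine fun n => measurable_expNeg.comp (Finset.measurable_fun_sum _ fun i _ => ?_)
    have : (fun ω : (ℕ → ℕ) × ((Σ _ : ℕ, ℕ) → Y) =>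
        ∑ j ∈ Finset.range (ω.1 i), F (ω.2 ⟨i, j⟩)) =
        fun ω => ∑' j, if j < ω.1 i then F (ω.2 ⟨i, j⟩) else 0 := by
      ext ω
      rw [tsum_eq_sum (s := Finset.range (ω.1 i)) fun j hj => if_neg (by simpa using hj)]
      exact Finset.sum_congr rfl fun j hj => (if_pos (Finset.mem_range.1 hj)).symm
    rw [this]
    exact Measurable.tsum fun j => measurable_active hF ⟨i, j⟩
  -- For finitely many layers: given the numbers `K i`, independence of the points yields `∏ s i ^ K
  -- i`, and the Poisson generating function is then applied layer by layer.
  have hpart : ∀ n, ∫⁻ ω, expNeg (∑ i ∈ Finset.range n, ∑ j ∈ Finset.range (ω.1 i),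
      F (ω.2 ⟨i, j⟩)) ∂(poissonLaw c π) = expNeg (∑ i ∈ Finset.range n, c i * (1 - s i)) := by
    intro n
    rw [poissonLaw, lintegral_prod _ (hmeas n).aemeasurable]
    have hinner : ∀ K : ℕ → ℕ, ∫⁻ z, expNeg (∑ i ∈ Finset.range n, ∑ j ∈ Finset.range (K i),
        F (z ⟨i, j⟩)) ∂(Measure.infinitePi fun p : (Σ _ : ℕ, ℕ) => π p.1) =
        ∏ i ∈ Finset.range n, s i ^ K i := by
      intro K
      have h1 : ∀ z : (Σ _ : ℕ, ℕ) → Y, expNeg (∑ i ∈ Finset.range n, ∑ j ∈ Finset.range (K i),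
          F (z ⟨i, j⟩)) = ∏ p ∈ (Finset.range n).sigma fun i => Finset.range (K i),
            expNeg (F (z p)) := by
        intro z
        rw [← expNeg_sum, Finset.sum_sigma]
      simp only [h1]
      rw [lintegral_prod_eq_prod_lintegral_of_indepFun _
        (fun (p : Σ _ : ℕ, ℕ) (z : (Σ _ : ℕ, ℕ) → Y) => expNeg (F (z p)))
        (iIndepFun_infinitePi (X := fun _ y => expNeg (F y)) fun _ => heF)
        (fun p => heF.comp (measurable_pi_apply p))]
      have h2 : ∀ p : (Σ _ : ℕ, ℕ), ∫⁻ z, expNeg (F (z p))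
          ∂(Measure.infinitePi fun p : (Σ _ : ℕ, ℕ) => π p.1) = s p.1 := fun p =>
        (measurePreserving_eval_infinitePi (fun p : (Σ _ : ℕ, ℕ) => π p.1) p).lintegral_comp heF
      simp only [h2]
      rw [Finset.prod_sigma]
      simp
    simp only [hinner]
    rw [lintegral_prod_eq_prod_lintegral_of_indepFun _
      (fun (i : ℕ) (K : ℕ → ℕ) => s i ^ K i)
      (iIndepFun_infinitePi (X := fun i k => s i ^ k) fun _ => measurable_of_countable _)
      (fun i => (measurable_of_countable fun k : ℕ => s i ^ k).comp (measurable_pi_apply i)),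
      expNeg_sum]
    refine Finset.prod_congr rfl fun i _ => ?_
    rw [← lintegral_pow_poissonMeasure (c i) (hs1 i)]
    exact (measurePreserving_eval_infinitePi (fun i => poissonMeasure (c i)) i).lintegral_comp
      (measurable_of_countable fun k : ℕ => s i ^ k)
  have hlimR : Tendsto (fun n => expNeg (∑ i ∈ Finset.range n, c i * (1 - s i))) atTop
      (𝓝 (expNeg (∑' i, c i * (1 - s i)))) :=
    (continuous_expNeg.tendsto _).comp (ENNReal.tendsto_nat_tsum _)
  rw [hR]
  refine tendsto_nhds_unique ?_ hlimR
  simp only [← hpart]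
  refine tendsto_lintegral_of_dominated_convergence' (fun _ => 1) (fun n => (hmeas n).aemeasurable)
    (fun n => ae_of_all _ fun ω => expNeg_le_one _) (by simp) (ae_of_all _ fun ω => ?_)
  rw [tsum_active_eq ω.1 fun p => F (ω.2 p)]
  exact (continuous_expNeg.tendsto _).comp (ENNReal.tendsto_nat_tsum _)

/-- The intensity of a Poisson process. -/
lemma lintegral_poissonLaw {F : Y → ℝ≥0∞} (hF : Measurable F) :
    ∫⁻ ω, (∑' p : (Σ _ : ℕ, ℕ), if p.2 < ω.1 p.1 then F (ω.2 p) else 0) ∂(poissonLaw c π) =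
      ∫⁻ y, F y ∂(Measure.sum fun i => (c i : ℝ≥0∞) • π i) := by
  rw [lintegral_tsum fun p => (measurable_active hF p).aemeasurable, ENNReal.tsum_sigma',
    lintegral_sum_measure]
  refine tsum_congr fun i => ?_
  rw [lintegral_smul_measure, smul_eq_mul]
  have hterm : ∀ j, ∫⁻ ω, (if j < ω.1 i then F (ω.2 ⟨i, j⟩) else 0) ∂(poissonLaw c π) =
      (∫⁻ k, (if j < k then 1 else 0) ∂(poissonMeasure (c i))) * ∫⁻ y, F y ∂(π i) := by
    intro j
    have h1 : ∀ ω : (ℕ → ℕ) × ((Σ _ : ℕ, ℕ) → Y), (if j < ω.1 i then F (ω.2 ⟨i, j⟩) else 0) =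
        (if j < ω.1 i then 1 else 0) * F (ω.2 ⟨i, j⟩) := fun ω => by split_ifs <;> simp
    simp only [h1]
    rw [poissonLaw, lintegral_prod_mul (f := fun K : ℕ → ℕ => if j < K i then 1 else 0)
      (g := fun z : (Σ _ : ℕ, ℕ) → Y => F (z ⟨i, j⟩))
      (((measurable_of_countable fun k : ℕ => if j < k then (1 : ℝ≥0∞) else 0).comp
        (measurable_pi_apply i)).aemeasurable)
      (hF.comp (measurable_pi_apply _)).aemeasurable]
    congr 1
    · exact (measurePreserving_eval_infinitePi (fun i => poissonMeasure (c i)) i).lintegral_comp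
        (measurable_of_countable fun k : ℕ => if j < k then (1 : ℝ≥0∞) else 0)
    · exact (measurePreserving_eval_infinitePi
        (fun p : (Σ _ : ℕ, ℕ) => π p.1) ⟨i, j⟩).lintegral_comp hF
  simp only [hterm]
  rw [ENNReal.tsum_mul_right, ← lintegral_tsum fun j => (measurable_of_countable _).aemeasurable,
    ← lintegral_natCast_poissonMeasure (c i)]
  congr 1
  refine lintegral_congr fun k => ?_
  rw [tsum_eq_sum (s := Finset.range k) fun j hj => if_neg (by simpa using hj),
    Finset.sum_congr rfl fun j hj => if_pos (Finset.mem_range.1 hj)]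
  simp

lemma ae_poissonLaw_eval {p : Y → Prop} (h : ∀ i, ∀ᵐ y ∂(π i), p y) :
    ∀ᵐ ω ∂(poissonLaw c π), ∀ q, p (ω.2 q) := by
  rw [ae_all_iff]
  intro q
  have h1 := (measurePreserving_eval_infinitePi (fun p : (Σ _ : ℕ, ℕ) => π p.1) q).comp
    (measurePreserving_snd (μ := Measure.infinitePi fun i => poissonMeasure (c i))
      (ν := Measure.infinitePi fun p : (Σ _ : ℕ, ℕ) => π p.1))
  exact h1.quasiMeasurePreserving.ae (h q.1)

lemma ae_poissonLaw_eval_pair {p : Y → Y → Prop}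
    (h : ∀ i j, ∀ᵐ y ∂((π i).prod (π j)), p y.1 y.2) :
    ∀ᵐ ω ∂(poissonLaw c π), ∀ q r, q ≠ r → p (ω.2 q) (ω.2 r) := by
  rw [ae_all_iff]
  intro q
  rw [ae_all_iff]
  intro r
  rw [Filter.eventually_imp_distrib_left]
  intro hqr
  have h0 : MeasurePreserving (fun z : (Σ _ : ℕ, ℕ) → Y => (z q, z r))
      (Measure.infinitePi fun p : (Σ _ : ℕ, ℕ) => π p.1) ((π q.1).prod (π r.1)) :=
    ⟨by fun_prop, Measure.infinitePi_map_eval_prod (P := fun p : (Σ _ : ℕ, ℕ) => π p.1) hqr⟩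
  have h1 := h0.comp
    (measurePreserving_snd (μ := Measure.infinitePi fun i => poissonMeasure (c i))
      (ν := Measure.infinitePi fun p : (Σ _ : ℕ, ℕ) => π p.1))
  exact h1.quasiMeasurePreserving.ae (h q.1 r.1)

/-- Normalise the pieces of an s-finite decomposition. A zero piece gets coefficient zero and a
dummy probability, chosen absolutely continuous so that `ν`-null sets stay null in every layer. -/
lemma exists_sum_smul_probability (ν : Measure Y) [SFinite ν] (hν : ν ≠ 0) :
    ∃ (c : ℕ → ℝ≥0) (π : ℕ → Measure Y), (∀ i, IsProbabilityMeasure (π i)) ∧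
      (∀ i, π i ≪ ν) ∧ (Measure.sum fun i => (c i : ℝ≥0∞) • π i) = ν := by
  classical
  have : NeZero ν := ⟨hν⟩
  refine ⟨fun i => (sfiniteSeq ν i univ).toNNReal, fun i => if sfiniteSeq ν i = 0 then ν.toFinite
    else (sfiniteSeq ν i univ)⁻¹ • sfiniteSeq ν i, fun i => ?_, fun i => ?_, ?_⟩
  · dsimp only
    split_ifs with h
    · infer_instance
    · have : NeZero (sfiniteSeq ν i) := ⟨h⟩
      exact isProbabilityMeasureSMul
  · dsimp only
    split_ifs with h
    · exact toFinite_absolutelyContinuous ν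
    · refine Measure.smul_absolutelyContinuous.trans ?_
      conv_rhs => rw [← sum_sfiniteSeq ν]
      exact Measure.absolutelyContinuous_sum_right i Measure.AbsolutelyContinuous.rfl
  · conv_rhs => rw [← sum_sfiniteSeq ν]
    congr 1
    ext1 i
    rw [ENNReal.coe_toNNReal (measure_ne_top _ _)]
    dsimp only
    split_ifs with h
    · simp [h]
    · rw [smul_smul, ENNReal.mul_inv_cancel (by simpa using h) (measure_ne_top _ _), one_smul]

end Poisson

end TPoint

namespace TPoint

open Filter Topology BoundedContinuousFunction

/-! ### Laplace functionals determine laws -/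

section Laplace

/-- The coordinate functions `x ↦ exp (-x i)` on a cube `[0, ∞]^ι`. -/
noncomputable def expNegCoord {ι : Type*} (i : ι) : (ι → ℝ≥0∞) →ᵇ ℝ :=
  mkOfCompact ⟨fun x => (expNeg (x i)).toReal, ENNReal.continuousOn_toReal.comp_continuous
    (continuous_expNeg.comp (continuous_apply i)) fun _ => expNeg_ne_top _⟩

@[simp] lemma expNegCoord_apply {ι : Type*} (i : ι) (x : ι → ℝ≥0∞) :
    expNegCoord i x = (expNeg (x i)).toReal := rfl

/-- A finite measure on a cube `[0, ∞]^ι` is determined by its Laplace transform. -/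
lemma measure_pi_ext_of_laplace {ι : Type*} [Fintype ι] {P P' : Measure (ι → ℝ≥0∞)}
    [IsFiniteMeasure P] [IsFiniteMeasure P']
    (h : ∀ n : ι → ℕ, ∫⁻ x, expNeg (∑ i, n i • x i) ∂P = ∫⁻ x, expNeg (∑ i, n i • x i) ∂P') :
    P = P' := by
  classical
  set S : Set ((ι → ℝ≥0∞) →ᵇ ℝ) := range expNegCoord with hS
  -- Products of coordinate exponentials are again exponentials of integer combinations, so the
  -- separating algebra they generate is just their span.
  have hclosure : ∀ b ∈ Submonoid.closure S, ∃ n : ι → ℕ, ∀ x,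
      b x = (expNeg (∑ i, n i • x i)).toReal := by
    intro b hb
    induction hb using Submonoid.closure_induction with
    | mem b hb =>
      obtain ⟨i, rfl⟩ := hb
      refine ⟨Pi.single i 1, fun x => ?_⟩
      rw [Finset.sum_eq_single i (fun j _ hj => by simp [hj]) (by simp)]
      simp
    | one => exact ⟨0, fun x => by simp⟩
    | mul a b _ _ ha hb =>
      obtain ⟨n, hn⟩ := ha
      obtain ⟨m, hm⟩ := hb
      refine ⟨n + m, fun x => ?_⟩
      simp only [BoundedContinuousFunction.mul_apply, hn, hm, Pi.add_apply, add_nsmul,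
        Finset.sum_add_distrib, expNeg_add, ENNReal.toReal_mul]
  have hint : ∀ b ∈ Algebra.adjoin ℝ S, ∫ x, b x ∂P = ∫ x, b x ∂P' := by
    intro b hb
    rw [← Subalgebra.mem_toSubmodule, Algebra.adjoin_eq_span] at hb
    induction hb using Submodule.span_induction with
    | mem b hb =>
      obtain ⟨n, hn⟩ := hclosure b hb
      have hm : Measurable fun x : ι → ℝ≥0∞ => expNeg (∑ i, n i • x i) :=
        measurable_expNeg.comp (Finset.measurable_fun_sum _ fun i _ =>
          (measurable_pi_apply i).const_smul (n i))
      simp only [hn]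
      rw [integral_toReal hm.aemeasurable (ae_of_all _ fun x => (expNeg_ne_top _).lt_top),
        integral_toReal hm.aemeasurable (ae_of_all _ fun x => (expNeg_ne_top _).lt_top), h]
    | zero => simp
    | add a b _ _ ha hb =>
      simp only [BoundedContinuousFunction.add_apply]
      rw [integral_add (a.integrable P) (b.integrable P),
        integral_add (a.integrable P') (b.integrable P'), ha, hb]
    | smul r a _ ha =>
      simp only [BoundedContinuousFunction.smul_apply]
      rw [integral_smul, integral_smul, ha]
  let A : StarSubalgebra ℝ ((ι → ℝ≥0∞) →ᵇ ℝ) :=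
    { Algebra.adjoin ℝ S with
      star_mem' := fun {a} ha => by
        have : star a = a := by ext x; simp
        rw [this]; exact ha }
  refine ext_of_forall_mem_subalgebra_integral_eq_of_polish (𝕜 := ℝ) (A := A) ?_ hint
  intro x y hxy
  obtain ⟨i, hi⟩ := Function.ne_iff.1 hxy
  refine ⟨fun x => expNegCoord i x, ⟨toContinuousMapStarₐ ℝ (expNegCoord i),
    ⟨expNegCoord i, Algebra.subset_adjoin ⟨i, rfl⟩, rfl⟩, rfl⟩, ?_⟩
  simp only [expNegCoord_apply]
  intro heq
  exact hi (expNeg_injective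
    ((ENNReal.toReal_eq_toReal_iff' (expNeg_ne_top _) (expNeg_ne_top _)).1 heq))

/-- The law of a random measure is determined by its Laplace functional. -/
lemma law_ext_of_laplace {X : Type*} [MeasurableSpace X] {P P' : Measure (Measure X)}
    [IsFiniteMeasure P] [IsFiniteMeasure P']
    (h : ∀ f : X → ℝ≥0∞, Measurable f →
      ∫⁻ ξ, expNeg (∫⁻ x, f x ∂ξ) ∂P = ∫⁻ ξ, expNeg (∫⁻ x, f x ∂ξ) ∂P') :
    P = P' := by
  let ev : Measure X → ({A : Set X // MeasurableSet A} → ℝ≥0∞) := fun ξ A => ξ A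
  have hev : Measurable ev := measurable_pi_lambda _ fun A => Measure.measurable_coe A.2
  -- Evaluations generate the σ-algebra, so it suffices to compare finite-dimensional marginals;
  -- there the Laplace transform is the functional at a simple function.
  have hle : (Measure.instMeasurableSpace : MeasurableSpace (Measure X)) ≤
      MeasurableSpace.comap ev inferInstance := by
    refine iSup_le fun A => iSup_le fun hA => ?_
    rw [← BorelSpace.measurable_eq (α := ℝ≥0∞)]
    exact ((measurable_pi_apply (⟨A, hA⟩ : {A : Set X // MeasurableSet A})).comp
      (comap_measurable ev)).comap_le
  have hmap : P.map ev = P'.map ev := by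
    refine IsProjectiveLimit.unique (P := fun I => (P'.map ev).map I.restrict) (fun I => ?_)
      fun I => rfl
    have hI : Measurable (I.restrict (π := fun _ => ℝ≥0∞)) := by fun_prop
    dsimp only
    rw [Measure.map_map hI hev, Measure.map_map hI hev]
    have hmeas : Measurable (I.restrict ∘ ev) := hI.comp hev
    refine measure_pi_ext_of_laplace fun n => ?_
    have hm : Measurable fun x : I → ℝ≥0∞ => expNeg (∑ i, n i • x i) :=
      measurable_expNeg.comp (Finset.measurable_fun_sum _ fun i _ =>
        (measurable_pi_apply i).const_smul (n i))
    rw [lintegral_map hm hmeas, lintegral_map hm hmeas]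
    have hterm : ∀ i : I, Measurable fun x => n i • (i : Set X).indicator (1 : X → ℝ≥0∞) x :=
      fun i => (measurable_one.indicator i.1.2).fun_const_smul (n i)
    have hf : Measurable fun x => ∑ i : I, n i • (i : Set X).indicator (1 : X → ℝ≥0∞) x :=
      Finset.measurable_fun_sum _ fun i _ => hterm i
    have heq : ∀ ξ : Measure X, ∑ i : I, n i • (I.restrict ∘ ev) ξ i =
        ∫⁻ x, ∑ i : I, n i • (i : Set X).indicator (1 : X → ℝ≥0∞) x ∂ξ := by
      intro ξ
      rw [lintegral_finsetSum _ fun i _ => hterm i]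
      refine Finset.sum_congr rfl fun i _ => ?_
      simp only [nsmul_eq_mul]
      rw [lintegral_const_mul _ (measurable_one.indicator i.1.2), lintegral_indicator_one i.1.2]
      rfl
    simp only [heq]
    exact h _ hf
  ext s hs
  obtain ⟨t, ht, rfl⟩ := hle s hs
  rw [← Measure.map_apply hev ht, hmap, Measure.map_apply hev ht]

end Laplace

end TPoint

namespace TPoint

open Filter Topology
open scoped NNReal

lemma sum_dirac_range_eq {ι X : Type*} [MeasurableSpace X] {f : ι → X} (hf : Function.Injective f) :
    (Measure.sum fun x : range f => Measure.dirac (x : X)) =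
      Measure.sum fun i => Measure.dirac (f i) := by
  ext A hA
  rw [Measure.sum_apply _ hA, Measure.sum_apply _ hA, ← (Equiv.ofInjective f hf).tsum_eq]
  rfl

/-! ### Superposition of clusters: intensity and invariance -/

section Superposition

variable {X : Type*} [MeasurableSpace X] (T : X ≃ᵐ X) {μ : Measure X} {h : ℕ → ℕ}

/-- The superposition of the clusters of the active points. -/
noncomputable def superpose (h : ℕ → ℕ) (ω : (ℕ → ℕ) × ((Σ _ : ℕ, ℕ) → (ℕ → Bool) × X)) :
    Measure X :=
  Measure.sum fun p : (Σ _ : ℕ, ℕ) => if p.2 < ω.1 p.1 then cluster T h (ω.2 p) else 0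

lemma lintegral_superpose (f : X → ℝ≥0∞) (ω : (ℕ → ℕ) × ((Σ _ : ℕ, ℕ) → (ℕ → Bool) × X)) :
    ∫⁻ x, f x ∂(superpose T h ω) =
      ∑' p : (Σ _ : ℕ, ℕ), if p.2 < ω.1 p.1 then ∫⁻ x, f x ∂(cluster T h (ω.2 p)) else 0 := by
  rw [superpose, lintegral_sum_measure]
  refine tsum_congr fun p => ?_
  split_ifs <;> simp

lemma superpose_apply {A : Set X} (hA : MeasurableSet A)
    (ω : (ℕ → ℕ) × ((Σ _ : ℕ, ℕ) → (ℕ → Bool) × X)) :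
    superpose T h ω A =
      ∑' p : (Σ _ : ℕ, ℕ), if p.2 < ω.1 p.1 then cluster T h (ω.2 p) A else 0 := by
  rw [superpose, Measure.sum_apply _ hA]
  refine tsum_congr fun p => ?_
  split_ifs <;> simp

lemma measurable_cluster_apply {A : Set X} (hA : MeasurableSet A) :
    Measurable fun y => cluster T h y A :=
  (Measure.measurable_coe hA).comp (measurable_cluster T)

lemma measurable_superpose : Measurable (superpose T h) := by
  refine Measure.measurable_of_measurable_coe _ fun A hA => ?_
  simp only [superpose_apply T hA]
  exact Measurable.tsum fun p => measurable_active (measurable_cluster_apply T hA) p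

/-- No point is repeated inside a cluster by freeness and sparsity, and different clusters lie on
different orbits. -/
lemma simple_superpose (hh : ∀ n, ∑ i ∈ Finset.range n, h i < h n)
    {ω : (ℕ → ℕ) × ((Σ _ : ℕ, ℕ) → (ℕ → Bool) × X)}
    (haper : ∀ q, ∀ k : ℤ, k ≠ 0 → iter T k (ω.2 q).2 ≠ (ω.2 q).2)
    (hdisj : ∀ q r, q ≠ r → (ω.2 r).2 ∉ orbit T (ω.2 q).2) :
    ∃ s : Set X, s.Countable ∧
      superpose T h ω = Measure.sum fun x : s => Measure.dirac (x : X) := by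
  let pt : {p : (Σ _ : ℕ, ℕ) // p.2 < ω.1 p.1} × Finset ℕ → X :=
    fun j => (move T h j.2 (ω.2 j.1)).2
  have hinj : Function.Injective pt := by
    rintro ⟨p, F⟩ ⟨q, G⟩ heq
    have hpq : p = q := by
      by_contra hne
      refine hdisj p q (fun h0 => hne (Subtype.ext h0)) ?_
      have h2 : orbit T (ω.2 p).2 = orbit T (ω.2 q).2 := by
        rw [← orbit_iter T (disp h F (ω.2 p).1), ← orbit_iter T (disp h G (ω.2 q).1) (ω.2 q).2]
        exact congrArg (orbit T) heq
      rw [h2]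
      exact ⟨0, rfl⟩
    subst hpq
    exact congrArg (Prod.mk p) (injective_move_snd T hh (haper p) heq)
  refine ⟨range pt, countable_range pt, ?_⟩
  rw [sum_dirac_range_eq hinj]
  ext A hA
  rw [superpose_apply T hA, Measure.sum_apply _ hA, ENNReal.tsum_prod']
  refine Eq.trans ?_ (tsum_subtype {p : (Σ _ : ℕ, ℕ) | p.2 < ω.1 p.1}
    fun p => ∑' F, Measure.dirac (move T h F (ω.2 p)).2 A).symm
  refine tsum_congr fun p => ?_
  by_cases hp : p.2 < ω.1 p.1
  · rw [if_pos hp, indicator_of_mem (by exact hp), cluster, Measure.sum_apply _ hA]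
  · rw [if_neg hp, indicator_of_notMem (by exact hp)]

variable (c : ℕ → ℝ≥0) (π : ℕ → Measure ((ℕ → Bool) × X)) [∀ i, IsProbabilityMeasure (π i)]
  {g : (ℕ → Bool) × X → ℝ≥0∞}

lemma measurable_lintegral_cluster {f : X → ℝ≥0∞} (hf : Measurable f) :
    Measurable fun y => ∫⁻ x, f x ∂(cluster T h y) :=
  (Measure.measurable_lintegral hf).comp (measurable_cluster T)

lemma lintegral_superpose_apply [SFinite μ] (hT : MeasurePreserving T μ μ) (hg : Measurable g)
    (h1 : ∀ᵐ y ∂(coins.prod μ), ∑' F, g (move T h F y) = 1)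
    (hν : (Measure.sum fun i => (c i : ℝ≥0∞) • π i) = (coins.prod μ).withDensity g)
    {A : Set X} (hA : MeasurableSet A) :
    ∫⁻ ω, superpose T h ω A ∂(poissonLaw c π) = μ A := by
  simp only [superpose_apply T hA]
  rw [lintegral_poissonLaw c π (measurable_cluster_apply T hA), hν,
    lintegral_withDensity_eq_lintegral_mul _ hg (measurable_cluster_apply T hA),
    ← lintegral_cluster_mul_weight T hT hg h1 hA]
  exact lintegral_congr fun y => mul_comm _ _

lemma lintegral_expNeg_superpose [SFinite μ] (hg : Measurable g)
    (hν : (Measure.sum fun i => (c i : ℝ≥0∞) • π i) = (coins.prod μ).withDensity g)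
    {f : X → ℝ≥0∞} (hf : Measurable f) :
    ∫⁻ ω, expNeg (∫⁻ x, f x ∂(superpose T h ω)) ∂(poissonLaw c π) =
      expNeg (∫⁻ y, (1 - expNeg (∫⁻ x, f x ∂(cluster T h y))) * g y ∂(coins.prod μ)) := by
  have hm := measurable_lintegral_cluster T (h := h) hf
  simp only [lintegral_superpose]
  rw [lintegral_expNeg_poissonLaw c π hm, hν,
    lintegral_withDensity_eq_lintegral_mul _ hg
      (show Measurable fun y => 1 - expNeg (∫⁻ x, f x ∂(cluster T h y)) from
        measurable_const.sub (measurable_expNeg.comp hm))]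
  congr 1
  exact lintegral_congr fun y => mul_comm _ _

/-- The law of the superposition of the clusters is invariant under `T`. -/
lemma map_map_superpose [SFinite μ] (hT : MeasurePreserving T μ μ) (hg : Measurable g)
    (h1 : ∀ᵐ y ∂(coins.prod μ), ∑' F, g (move T h F y) = 1)
    (hν : (Measure.sum fun i => (c i : ℝ≥0∞) • π i) = (coins.prod μ).withDensity g) :
    ((poissonLaw c π).map (superpose T h)).map (Measure.map T) =
      (poissonLaw c π).map (superpose T h) := by
  have hsup : Measurable (superpose T h) := measurable_superpose T
  have hmapT : Measurable (Measure.map T : Measure X → Measure X) :=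
    Measure.measurable_map _ T.measurable
  have := Measure.isProbabilityMeasure_map (μ := poissonLaw c π) hsup.aemeasurable
  refine law_ext_of_laplace fun f hf => ?_
  have he : Measurable fun ξ : Measure X => expNeg (∫⁻ x, f x ∂ξ) :=
    measurable_expNeg.comp (Measure.measurable_lintegral hf)
  have hfT : Measurable fun x => f (T x) := hf.comp T.measurable
  have heT : Measurable fun ξ : Measure X => expNeg (∫⁻ x, f x ∂(ξ.map T)) := he.comp hmapT
  rw [lintegral_map he hmapT, lintegral_map heT hsup,
    lintegral_map he hsup]
  simp only [lintegral_map hf T.measurable]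
  rw [lintegral_expNeg_superpose T c π hg hν hf, lintegral_expNeg_superpose T c π hg hν hfT]
  congr 1
  set H : (ℕ → Bool) × X → ℝ≥0∞ := fun y => 1 - expNeg (∫⁻ x, f x ∂(cluster T h y)) with hH
  have hHm : Measurable H :=
    measurable_const.sub (measurable_expNeg.comp (measurable_lintegral_cluster T hf))
  set R : (ℕ → Bool) × X → (ℕ → Bool) × X := Prod.map id T with hR
  set R' : (ℕ → Bool) × X → (ℕ → Bool) × X := Prod.map id T.symm with hR'
  have hRp : MeasurePreserving R (coins.prod μ) (coins.prod μ) :=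
    (MeasurePreserving.id coins).prod hT
  have hRp' : MeasurePreserving R' (coins.prod μ) (coins.prod μ) :=
    (MeasurePreserving.id coins).prod (hT.symm T)
  have hRR : ∀ y, R' (R y) = y := fun y => Prod.ext rfl (T.symm_apply_apply y.2)
  have hRR' : ∀ y, R (R' y) = y := fun y => Prod.ext rfl (T.apply_symm_apply y.2)
  -- Since `T` commutes with the moves, `g ∘ R'` is again a weight; as `H` is class-invariant, it
  -- may be exchanged for `g`.
  have hcomm : ∀ F y, R' (move T h F y) = move T h F (R' y) := by
    intro F y
    have : move T h F y = R (move T h F (R' y)) := by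
      conv_lhs => rw [← hRR' y]
      exact move_snd_apply T F _ _
    rw [this, hRR]
  calc ∫⁻ y, (1 - expNeg (∫⁻ x, f (T x) ∂(cluster T h y))) * g y ∂(coins.prod μ)
      = ∫⁻ y, H (R y) * g (R' (R y)) ∂(coins.prod μ) := by
        refine lintegral_congr fun y => ?_
        rw [hRR, hH]
        congr 3
        exact (lintegral_cluster_apply_snd T hf y.1 y.2).symm
    _ = ∫⁻ y, H y * g (R' y) ∂(coins.prod μ) :=
        hRp.lintegral_comp (f := fun y => H y * g (R' y))
          (hHm.mul (hg.comp hRp'.measurable))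
    _ = ∫⁻ y, H y * g y ∂(coins.prod μ) := by
        refine lintegral_mul_weight_eq T hT hHm (hg.comp hRp'.measurable) hg (fun F y => ?_) ?_ h1
        · simp only [hH, lintegral_cluster_move T hf]
        · filter_upwards [hRp'.quasiMeasurePreserving.ae h1] with y hy
          simpa only [Function.comp_apply, hcomm] using hy

end Superposition

/-! ### Almost sure properties of the superposition -/

section Good

variable {X : Type*} [MetricSpace X] [MeasurableSpace X] (T : X ≃ᵐ X)
  {μ : Measure X} {h : ℕ → ℕ}

/-- The simple counting measures with boundedly finite iterates under `T` and with infinitely many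
points on every orbit they charge. -/
structure HasInfiniteOrbits (ξ : Measure X) : Prop where
  boundedlyFinite : ∀ k : ℤ, BoundedlyFinite (ξ.map (iter T k))
  simple : ∃ s : Set X, s.Countable ∧ ξ = Measure.sum fun x : s => Measure.dirac (x : X)
  orbit_eq_top : ∀ x, ξ {x} = 1 → ξ (orbit T x) = ∞

lemma hasInfiniteOrbits_zero : HasInfiniteOrbits T (0 : Measure X) where
  boundedlyFinite k A _ _ := by simp
  simple := ⟨∅, countable_empty, by rw [Measure.sum_of_isEmpty]⟩
  orbit_eq_top x hx := by simp at hx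

variable [BorelSpace X]

-- `T` need not preserve boundedness; stability under iterates is why the definition asks for
-- finiteness of all iterates.
variable {T} in
lemma HasInfiniteOrbits.map_iter {ξ : Measure X} (hξ : HasInfiniteOrbits T ξ) (j : ℤ) :
    HasInfiniteOrbits T (ξ.map (iter T j)) where
  boundedlyFinite k := by
    rw [map_iter_map_iter]
    exact hξ.boundedlyFinite (k + j)
  simple := by
    obtain ⟨s, hs, rfl⟩ := hξ.simple
    have hinj : Function.Injective fun x : s => iter T j x :=
      (iter_injective T j).comp Subtype.val_injective
    have := hs.to_subtype
    refine ⟨range fun x : s => iter T j x, countable_range _, ?_⟩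
    rw [sum_dirac_range_eq hinj, Measure.map_sum (measurable_iter T j).aemeasurable]
    congr 1
    ext1 x
    exact Measure.map_dirac' (measurable_iter T j) _
  orbit_eq_top x hx := by
    have hpre : ∀ z, iter T j z = x ↔ z = iter T (-j) x := fun z =>
      ⟨fun hz => by rw [← hz, iter_neg_iter], fun hz => by rw [hz, iter_iter_neg]⟩
    rw [Measure.map_apply (measurable_iter T j) (measurableSet_singleton x)] at hx
    rw [Measure.map_apply (measurable_iter T j) (countable_orbit T x).measurableSet]
    have h1 : iter T j ⁻¹' {x} = {iter T (-j) x} := by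
      ext z
      exact hpre z
    rw [h1] at hx
    rw [← hξ.orbit_eq_top _ hx]
    congr 1
    ext z
    constructor
    · rintro ⟨k, hk⟩
      refine ⟨k, ?_⟩
      change iter T k (iter T (-j) x) = z
      apply iter_injective T j
      rw [← iter_add, ← iter_add, show j + k + -j = k by ring]
      exact hk
    · rintro ⟨k, rfl⟩
      refine ⟨k, ?_⟩
      change iter T k x = iter T j (iter T k (iter T (-j) x))
      rw [← iter_add, ← iter_add, show j + k + -j = k by ring]

lemma orbit_superpose_eq_top {ω : (ℕ → ℕ) × ((Σ _ : ℕ, ℕ) → (ℕ → Bool) × X)} {x : X}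
    (hx : superpose T h ω {x} ≠ 0) : superpose T h ω (orbit T x) = ∞ := by
  rw [superpose_apply T (measurableSet_singleton x)] at hx
  obtain ⟨p, hp⟩ : ∃ p : (Σ _ : ℕ, ℕ),
      (if p.2 < ω.1 p.1 then cluster T h (ω.2 p) {x} else 0) ≠ 0 := by
    by_contra! hcon
    exact hx (ENNReal.tsum_eq_zero.2 hcon)
  split_ifs at hp with hact
  · rw [cluster_apply T (measurableSet_singleton x)] at hp
    obtain ⟨F, hF⟩ : ∃ F, ({x} : Set X).indicator (1 : X → ℝ≥0∞) (move T h F (ω.2 p)).2 ≠ 0 := by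
      by_contra! hcon
      exact hp (ENNReal.tsum_eq_zero.2 hcon)
    have hxF : (move T h F (ω.2 p)).2 = x := by
      by_contra hne
      exact hF (indicator_of_notMem (by simpa using hne) _)
    have horb : orbit T x = orbit T (ω.2 p).2 := by
      rw [← hxF]
      exact orbit_iter T _ _
    rw [horb, superpose_apply T (countable_orbit T _).measurableSet, eq_top_iff]
    refine le_trans ?_ (ENNReal.le_tsum p)
    rw [if_pos hact, cluster_orbit]
  · exact absurd rfl hp

variable [TopologicalSpace.SeparableSpace X] (c : ℕ → ℝ≥0)
  (π : ℕ → Measure ((ℕ → Bool) × X)) [∀ i, IsProbabilityMeasure (π i)]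
  {g : (ℕ → Bool) × X → ℝ≥0∞}

/-- Fubini: orbits are countable and `μ` has no atoms. -/
lemma ae_notMem_orbit [SFinite μ] (hsing : ∀ x, μ {x} = 0) :
    ∀ᵐ y ∂((coins.prod μ).prod (coins.prod μ)), y.2.2 ∉ orbit T y.1.2 := by
  have := UniformSpace.secondCountable_of_separable X
  have hall : ∀ᵐ y ∂((coins.prod μ).prod (coins.prod μ)), ∀ k : ℤ, iter T k y.1.2 ≠ y.2.2 := by
    rw [ae_all_iff]
    intro k
    have hms : MeasurableSet {y : ((ℕ → Bool) × X) × ((ℕ → Bool) × X) |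
        iter T k y.1.2 = y.2.2} :=
      measurableSet_eq_fun ((measurable_iter T k).comp (measurable_snd.comp measurable_fst))
        (measurable_snd.comp measurable_snd)
    have hnull := (Measure.measure_prod_null (μ := coins.prod μ) (ν := coins.prod μ) hms).2 ?_
    · exact measure_eq_zero_iff_ae_notMem.1 hnull
    · refine ae_of_all _ fun y => ?_
      have : Prod.mk y ⁻¹' {y : ((ℕ → Bool) × X) × ((ℕ → Bool) × X) | iter T k y.1.2 = y.2.2} =
          univ ×ˢ {iter T k y.2} := by
        ext z
        simp [eq_comm]
      dsimp only
      rw [this, Measure.prod_prod, hsing]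
      simp
  filter_upwards [hall] with y hy
  rintro ⟨k, hk⟩
  exact hy k hk

lemma ae_hasInfiniteOrbits_superpose (hμ : BoundedlyFinite μ) [SigmaFinite μ]
    (hinf : μ univ = ∞) (herg : Ergodic T μ) (hsing : ∀ x, μ {x} = 0)
    (hh : ∀ n, ∑ i ∈ Finset.range n, h i < h n) (hg : Measurable g)
    (h1 : ∀ᵐ y ∂(coins.prod μ), ∑' F, g (move T h F y) = 1)
    (hν : (Measure.sum fun i => (c i : ℝ≥0∞) • π i) = (coins.prod μ).withDensity g)
    (hπ : ∀ i, π i ≪ (coins.prod μ).withDensity g) :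
    ∀ᵐ ω ∂(poissonLaw c π), HasInfiniteOrbits T (superpose T h ω) := by
  have hT := herg.toMeasurePreserving
  have hπ' : ∀ i, π i ≪ coins.prod μ := fun i =>
    (hπ i).trans (withDensity_absolutelyContinuous _ _)
  have haper : ∀ᵐ ω ∂(poissonLaw c π), ∀ q, ∀ k : ℤ, k ≠ 0 → iter T k (ω.2 q).2 ≠ (ω.2 q).2 :=
    ae_poissonLaw_eval c π fun i => (hπ' i).ae_le
      (Measure.quasiMeasurePreserving_snd.ae (ae_iter_ne_self T herg hinf))
  have hdisj : ∀ᵐ ω ∂(poissonLaw c π), ∀ q r, q ≠ r → (ω.2 r).2 ∉ orbit T (ω.2 q).2 :=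
    ae_poissonLaw_eval_pair c π (p := fun y z => z.2 ∉ orbit T y.2) fun i j =>
      ((hπ' i).prod (hπ' j)).ae_le (ae_notMem_orbit T hsing)
  obtain ⟨x₀⟩ : Nonempty X := by
    by_contra hX
    rw [not_nonempty_iff] at hX
    simp [Measure.eq_zero_of_isEmpty μ] at hinf
  have hball : ∀ n : ℕ, MeasurableSet (Metric.ball x₀ (n : ℝ)) := fun n =>
    Metric.isOpen_ball.measurableSet
  -- The mean number of points in the preimage of a ball under any iterate is the `μ`-mass of the
  -- ball, which is finite.
  have hfin : ∀ᵐ ω ∂(poissonLaw c π), ∀ (k : ℤ) (n : ℕ),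
      superpose T h ω (iter T k ⁻¹' Metric.ball x₀ n) < ∞ := by
    rw [ae_all_iff]
    intro k
    rw [ae_all_iff]
    intro n
    have hms := measurable_iter T k (hball n)
    refine ae_lt_top ((Measure.measurable_coe hms).comp (measurable_superpose T)) ?_
    have := lintegral_superpose_apply T c π hT hg h1 hν hms
    rw [(measurePreserving_iter T hT k).measure_preimage (hball n).nullMeasurableSet] at this
    refine this.trans_ne ?_
    exact (hμ _ (hball n) Metric.isBounded_ball).ne
  filter_upwards [haper, hdisj, hfin] with ω h2 h3 h4
  refine ⟨fun k A hA hAb => ?_, simple_superpose T hh h2 h3, fun x hx => ?_⟩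
  · obtain ⟨r, hr⟩ := hAb.subset_ball x₀
    obtain ⟨n, hn⟩ := exists_nat_ge r
    rw [Measure.map_apply (measurable_iter T k) hA]
    exact (measure_mono (preimage_mono (hr.trans (Metric.ball_subset_ball hn)))).trans_lt (h4 k n)
  · exact orbit_superpose_eq_top T (by rw [hx]; exact one_ne_zero)

end Good

/-! ### The canonical configuration space -/

section Pushforward

variable {X : Type*} [MetricSpace X] [MeasurableSpace X] (T : X ≃ᵐ X)

/-- A simple counting measure with infinite orbits, as an element of `X^*`. -/
def toSimple (ξ : {ξ : Measure X // HasInfiniteOrbits T ξ}) : SimpleCountingMeasure X :=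
  ⟨ξ.1, by
    have := ξ.2.boundedlyFinite 0
    rwa [show iter T 0 = id from rfl, Measure.map_id] at this, ξ.2.simple⟩

lemma measurable_toSimple : Measurable (toSimple T) := by
  refine measurable_iff_le_map.2 (iSup_le fun A => iSup_le fun hA => iSup_le fun _ => ?_)
  rw [MeasurableSpace.comap_le_iff_le_map, MeasurableSpace.map_comp]
  exact measurable_iff_le_map.1 ((Measure.measurable_coe hA).comp measurable_subtype_coe)

variable [BorelSpace X]

/-- The push-forward by `T`, acting on the simple counting measures with infinite orbits. -/
noncomputable def pushEquiv : {ξ : Measure X // HasInfiniteOrbits T ξ} ≃ᵐ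
    {ξ : Measure X // HasInfiniteOrbits T ξ} where
  toFun ξ := ⟨ξ.1.map (iter T 1), ξ.2.map_iter 1⟩
  invFun ξ := ⟨ξ.1.map (iter T (-1)), ξ.2.map_iter (-1)⟩
  left_inv ξ := Subtype.ext (by
    change (ξ.1.map (iter T 1)).map (iter T (-1)) = ξ.1
    rw [map_iter_map_iter, neg_add_cancel]
    exact Measure.map_id)
  right_inv ξ := Subtype.ext (by
    change (ξ.1.map (iter T (-1))).map (iter T 1) = ξ.1
    rw [map_iter_map_iter, add_neg_cancel]
    exact Measure.map_id)
  measurable_toFun :=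
    ((Measure.measurable_map _ (measurable_iter T 1)).comp measurable_subtype_coe).subtype_mk
  measurable_invFun :=
    ((Measure.measurable_map _ (measurable_iter T (-1))).comp measurable_subtype_coe).subtype_mk

lemma map_val_injective {α : Type*} [MeasurableSpace α] {p : α → Prop} {P P' : Measure {a // p a}}
    (h : P.map Subtype.val = P'.map Subtype.val) : P = P' := by
  ext s hs
  obtain ⟨t, ht, rfl⟩ := hs
  rw [← Measure.map_apply measurable_subtype_coe ht, h, Measure.map_apply measurable_subtype_coe ht]

end Pushforward

end TPoint

/-! ### Assembly of the process -/

open TPoint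

theorem mainTheorem12 {X : Type u} [MetricSpace X] [CompleteSpace X]
    [TopologicalSpace.SeparableSpace X] [MeasurableSpace X] [BorelSpace X]
    (μ : Measure X) (hμ : TPoint.BoundedlyFinite μ) (hinf : μ Set.univ = ∞)
    (T : X ≃ᵐ X) (hcons : Conservative T μ) (herg : Ergodic T μ) :
    ∃ (Ω : Type u) (_ : MeasurableSpace Ω) (P : Measure Ω)
      (N : Ω → TPoint.SimpleCountingMeasure X),
      TPoint.IsTPointProcess μ T P N ∧
      TPoint.HasIntensity P N μ ∧
      ∀ᵐ ω ∂P, ∀ x : X, (N ω).toMeasure {x} = 1 → (N ω).toMeasure (TPoint.orbit T x) = ∞ := by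
  classical
  have hσ := sigmaFinite_of_boundedlyFinite hμ
  have hT := herg.toMeasurePreserving
  have hsing := measure_singleton_eq_zero T hcons herg hinf
  obtain ⟨x₀⟩ : Nonempty X := by
    by_contra hX
    rw [not_nonempty_iff] at hX
    simp [Measure.eq_zero_of_isEmpty μ] at hinf
  have hball : ∀ n : ℕ, MeasurableSet (Metric.ball x₀ (n : ℝ)) := fun n =>
    Metric.isOpen_ball.measurableSet
  have hballfin : ∀ n : ℕ, μ (Metric.ball x₀ (n : ℝ)) ≠ ∞ := fun n =>
    (hμ _ (hball n) Metric.isBounded_ball).ne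
  obtain ⟨h, hh⟩ := exists_sparse_times T herg hinf hball hballfin
  obtain ⟨g, hg, h1⟩ := exists_weight T hball hballfin
    (fun m n hmn => Metric.ball_subset_ball (by exact_mod_cast hmn)) (Metric.iUnion_ball_nat x₀)
    fun n => (hh n).2
  -- Otherwise the mean total mass of the clusters would be zero instead of `μ univ = ∞`.
  have hν0 : (coins.prod μ).withDensity g ≠ 0 := by
    intro h0
    have h2 := lintegral_cluster_mul_weight T hT hg h1 MeasurableSet.univ
    have h3 := lintegral_withDensity_eq_lintegral_mul (coins.prod μ) hg
      (measurable_cluster_apply T (h := h) MeasurableSet.univ)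
    rw [h0, lintegral_zero_measure] at h3
    rw [hinf] at h2
    simp only [Pi.mul_apply, mul_comm (g _)] at h3
    rw [h2] at h3
    exact ENNReal.zero_ne_top h3
  obtain ⟨c, π, hprob, hπ, hν⟩ := exists_sum_smul_probability _ hν0
  have hae := ae_hasInfiniteOrbits_superpose T c π hμ hinf herg hsing (fun n => (hh n).1) hg h1 hν hπ
  obtain ⟨E, hE, hEm, hEG⟩ := hae.exists_measurable_mem
  have hsup : Measurable (superpose T h) := measurable_superpose T
  -- Off a measurable set of full measure the value is the zero measure, so every realisation is an
  -- admissible configuration.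
  let N₀ : (ℕ → ℕ) × ((Σ _ : ℕ, ℕ) → (ℕ → Bool) × X) → {ξ : Measure X // HasInfiniteOrbits T ξ} :=
    fun ω => ⟨if ω ∈ E then superpose T h ω else 0, by
      split_ifs with hω
      · exact hEG ω hω
      · exact hasInfiniteOrbits_zero T⟩
  have hN₀ : Measurable N₀ := (Measurable.ite hEm hsup measurable_const).subtype_mk
  -- Only the law of the superposition is known to be invariant. Passing to the configuration space
  -- turns this into an invertible transformation, with the equivariance of `N` valid at every
  -- point.
  set P := (poissonLaw c π).map N₀ with hP
  have hPval : P.map Subtype.val = (poissonLaw c π).map (superpose T h) := by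
    rw [hP, Measure.map_map measurable_subtype_coe hN₀]
    refine Measure.map_congr ?_
    filter_upwards [hE] with ω hω
    exact if_pos hω
  have hint : HasIntensity P (toSimple T) μ := by
    intro A hA
    rw [← lintegral_superpose_apply T c π hT hg h1 hν hA]
    have h2 := lintegral_map (μ := P) (f := fun ξ : Measure X => ξ A) (g := Subtype.val)
      (Measure.measurable_coe hA) measurable_subtype_coe
    rw [hPval, lintegral_map (Measure.measurable_coe hA) hsup] at h2
    exact h2.symm
  refine ⟨_, inferInstance, P, toSimple T, ⟨?_, measurable_toSimple T, ?_, pushEquiv T,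
    ⟨(pushEquiv T).measurable, ?_⟩, ?_⟩, hint, ae_of_all _ fun ξ => ξ.2.orbit_eq_top⟩
  · exact Measure.isProbabilityMeasure_map hN₀.aemeasurable
  · intro A hA hA0
    have h2 := hint A hA
    rw [hA0, lintegral_eq_zero_iff (f := fun ξ => (toSimple T ξ).toMeasure A)
      ((Measure.measurable_coe hA).comp measurable_subtype_coe)] at h2
    exact h2
  · apply map_val_injective
    have hmapT : Measurable (Measure.map T : Measure X → Measure X) :=
      Measure.measurable_map _ T.measurable
    rw [Measure.map_map measurable_subtype_coe (pushEquiv T).measurable, hPval,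
      ← map_map_superpose T c π hT hg h1 hν, ← hPval,
      Measure.map_map hmapT measurable_subtype_coe]
    rfl
  · intro A hA ξ
    exact Measure.map_apply T.measurable hA
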